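/- Let $n\ge 3$. Let $d\sigma^2$ be the standard metric of the unit sphere $S^{n-1}\subset\mathbb R^n$, and let $S^n\subset\mathbb R^{n+1}$ be the unit sphere with its standard metric. For $a>0$ and a function $f$ that is smooth on $[0,a]$, positive on $(0,a)$ and satisfies $f(0)=f(a)=0$, let $M=[0,a]\times_f S^{n-1}$ be the axis symmetric space with metric $g=dt^2+f(t)^2\,d\sigma^2$, in which each of the ends $\{0\}\times S^{n-1}$ and $\{a\}\times S^{n-1}$ is collapsed to a point (a pole). There is a constant $\varepsilon=\varepsilon(n)\in(0,1)$, depending only on $n$, such that for all such $a$ and $f$: if the Ricci and scalar curvatures of $g$ satisfy $$\mathrm{Ric}\ \ge\ \varepsilon\,(n-1)\,g\qquad\text{and}\qquad R\ \ge\ n(n-1)$$ on $(0,a)\times S^{n-1}$, i.e. away from the two poles, then $\mathrm{vol}(M)\le \mathrm{vol}(S^n)$. (It is not required that $g$ be smooth across the poles; every axis symmetric metric that is smooth there is included.) -/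

import Mathlib

open Set Metric MeasureTheory
open scoped Manifold ContDiff ENNReal

noncomputable section

namespace WarpedFootball

section Coordinates

/-! Classical tensor calculus in one coordinate system. `E` is the coordinate space, `b` a basis
of `E` (the coordinate directions), and `g : E → Matrix ι ι ℝ` the components `g i j` of the metric
with respect to `b`, as functions of the coordinates. -/

variable {E : Type*} [NormedAddCommGroup E] [NormedSpace ℝ E]
  {ι : Type*} [Fintype ι] [DecidableEq ι]

/-- The partial derivative `∂ᵢ h` at `y`. -/
def pderiv (b : Module.Basis ι ℝ E) (i : ι) (h : E → ℝ) (y : E) : ℝ :=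
  fderiv ℝ h y (b i)

/-- The Christoffel symbol
`Γ^k_{ij} = (1/2) ∑_l g^{kl} (∂ᵢ g_{jl} + ∂ⱼ g_{il} - ∂ₗ g_{ij})` at `y`. -/
def christoffel (b : Module.Basis ι ℝ E) (g : E → Matrix ι ι ℝ) (k i j : ι) (y : E) : ℝ :=
  (1 / 2) * ∑ l, (g y)⁻¹ k l *
    (pderiv b i (fun z => g z j l) y + pderiv b j (fun z => g z i l) y
      - pderiv b l (fun z => g z i j) y)

/-- The components of the Ricci tensor,
`Ric_{jk} = ∑_i (∂ᵢ Γ^i_{jk} - ∂ₖ Γ^i_{ji}) + ∑_{i,p} (Γ^i_{ip} Γ^p_{jk} - Γ^i_{kp} Γ^p_{ji})`;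
the unit `n`-sphere has `Ric = (n - 1) g`. -/
def ricciCoord (b : Module.Basis ι ℝ E) (g : E → Matrix ι ι ℝ) (j k : ι) (y : E) : ℝ :=
  ∑ i, (pderiv b i (christoffel b g i j k) y - pderiv b k (christoffel b g i j i) y)
    + ∑ i, ∑ p, (christoffel b g i i p y * christoffel b g p j k y
      - christoffel b g i k p y * christoffel b g p j i y)

/-- The scalar curvature `R = ∑_{j,k} g^{jk} Ric_{jk}`. -/
def scalarCoord (b : Module.Basis ι ℝ E) (g : E → Matrix ι ι ℝ) (y : E) : ℝ :=
  ∑ j, ∑ k, (g y)⁻¹ j k * ricciCoord b g j k y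

end Coordinates

section Manifold

/-! Curvature and volume of a metric tensor `g` on a manifold `M` without boundary. The basis `b`
of the model space only serves to write components: nothing below depends on its choice. -/

variable {E : Type*} [NormedAddCommGroup E] [NormedSpace ℝ E]
  {H : Type*} [TopologicalSpace H] (I : ModelWithCorners ℝ E H)
  {M : Type*} [TopologicalSpace M] [ChartedSpace H M]
  {ι : Type*} [Fintype ι] [DecidableEq ι]

/-- A real function of two tangent vectors at each point; the two that are used below,
`roundMetric` and `warpedMetric`, are symmetric bilinear. -/
abbrev MetricTensor (M : Type*) [TopologicalSpace M] [ChartedSpace H M] :=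
  ∀ x : M, TangentSpace I x → TangentSpace I x → ℝ

/-- The components of `g` in the chart around `x₀`: at the coordinates `y`, the `(i, j)` entry is
the value of `g` on the coordinate vector fields `∂ᵢ`, `∂ⱼ`. -/
def metricInChart (b : Module.Basis ι ℝ E) (g : MetricTensor I M) (x₀ : M) (y : E) :
    Matrix ι ι ℝ :=
  Matrix.of fun i j =>
    g ((extChartAt I x₀).symm y)
      (mfderiv 𝓘(ℝ, E) I (extChartAt I x₀).symm y (b i))
      (mfderiv 𝓘(ℝ, E) I (extChartAt I x₀).symm y (b j))

/-- The components of the tangent vector `v` at `x` in the chart around `x`. -/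
def vectorCoord (b : Module.Basis ι ℝ E) (x : M) (v : TangentSpace I x) (j : ι) : ℝ :=
  b.repr (mfderiv I 𝓘(ℝ, E) (extChartAt I x) x v : E) j

/-- The Ricci tensor `Ric(v, w)` of `g` at `x`, computed in the chart around `x`. -/
def ricci (b : Module.Basis ι ℝ E) (g : MetricTensor I M) (x : M) (v w : TangentSpace I x) : ℝ :=
  ∑ j, ∑ k, ricciCoord b (metricInChart I b g x) j k (extChartAt I x x) *
    vectorCoord I b x v j * vectorCoord I b x w k

/-- The scalar curvature of `g` at `x`, computed in the chart around `x`. -/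
def scalarCurvature (b : Module.Basis ι ℝ E) (g : MetricTensor I M) (x : M) : ℝ :=
  scalarCoord b (metricInChart I b g x) (extChartAt I x x)

variable [MeasurableSpace E] [BorelSpace E] [MeasurableSpace M]

/-- The Riemannian measure `√(det g) dy¹ ⋯ dyⁿ` on the domain of the chart around `x₀`, as a
measure on `M`. Here `b.addHaar` is the Lebesgue measure of the coordinates with respect to `b`. -/
def chartVolume (b : Module.Basis ι ℝ E) (g : MetricTensor I M) (x₀ : M) : Measure M :=
  ((b.addHaar.restrict (extChartAt I x₀).target).withDensity
    fun y => ENNReal.ofReal (Real.sqrt (metricInChart I b g x₀ y).det)).map (extChartAt I x₀).symm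

/-- The Riemannian measure of `g`. The measures `chartVolume` agree on overlaps of chart domains,
and the Riemannian measure, which restricts to each of them, is the smallest measure that is at
least each of them, i.e. their supremum in the lattice of measures. -/
def riemannianVolume (b : Module.Basis ι ℝ E) (g : MetricTensor I M) : Measure M :=
  ⨆ x₀ : M, chartVolume I b g x₀

end Manifold

section Spheres

/-- The unit sphere `S^d` in `ℝ^(d+1)`. -/
abbrev Sph (d : ℕ) : Type := sphere (0 : EuclideanSpace ℝ (Fin (d + 1))) 1

/-- The differential at `p` of the inclusion of `S^d` into `ℝ^(d+1)`. -/
def inclDeriv (d : ℕ) (p : Sph d) (v : TangentSpace (𝓡 d) p) : EuclideanSpace ℝ (Fin (d + 1)) :=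
  mfderiv (𝓡 d) 𝓘(ℝ, EuclideanSpace ℝ (Fin (d + 1)))
    (Subtype.val : Sph d → EuclideanSpace ℝ (Fin (d + 1))) p v

/-- The standard metric of `S^d`, induced by the inclusion into `ℝ^(d+1)`. -/
def roundMetric (d : ℕ) : MetricTensor (𝓡 d) (Sph d) := fun p v w =>
  inner ℝ (inclDeriv d p v) (inclDeriv d p w)

/-- The volume of the unit sphere `S^d` with its standard metric. -/
def sphereVolume (d : ℕ) : ℝ≥0∞ :=
  riemannianVolume (𝓡 d) (EuclideanSpace.basisFun (Fin d) ℝ).toBasis (roundMetric d) univ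

end Spheres

section Warped

/-- The model with corners of the cylinder `ℝ × S^d`. -/
abbrev cylModel (d : ℕ) := (𝓘(ℝ, ℝ)).prod (𝓡 d)

/-- The standard basis of `ℝ × ℝ^d`, the model space of `ℝ × S^d`. -/
def cylBasis (d : ℕ) : Module.Basis (Unit ⊕ Fin d) ℝ (ℝ × EuclideanSpace ℝ (Fin d)) :=
  (Module.Basis.singleton Unit ℝ).prod (EuclideanSpace.basisFun (Fin d) ℝ).toBasis

/-- The component of a tangent vector of `ℝ × S^d` along `ℝ`, i.e. its image under `dt`. -/
def dtPart (d : ℕ) (x : ℝ × Sph d) (v : TangentSpace (cylModel d) x) : ℝ :=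
  mfderiv (cylModel d) 𝓘(ℝ, ℝ) (Prod.fst : ℝ × Sph d → ℝ) x v

/-- The component of a tangent vector of `ℝ × S^d` along `S^d`. -/
def sphPart (d : ℕ) (x : ℝ × Sph d) (v : TangentSpace (cylModel d) x) : TangentSpace (𝓡 d) x.2 :=
  mfderiv (cylModel d) (𝓡 d) (Prod.snd : ℝ × Sph d → Sph d) x v

/-- The warped product tensor `dt² + f(t)² dσ²` on `ℝ × S^d`, where `dσ²` is the standard metric
of `S^d`. -/
def warpedMetric (d : ℕ) (f : ℝ → ℝ) : MetricTensor (cylModel d) (ℝ × Sph d) := fun x v w =>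
  dtPart d x v * dtPart d x w + (f x.1) ^ 2 * roundMetric d x.2 (sphPart d x v) (sphPart d x w)

/-- `f` is the warping function of an axis symmetric space `[0, a] ×_f S^d`: it is smooth on
`[0, a]`, positive inside, and vanishes at the two end points, so that each of the two ends
`{0} × S^d` and `{a} × S^d` collapses to a pole. The further conditions that make the metric smooth
across the poles, such as `f'(0) = 1 = -f'(a)`, are not imposed. -/
structure IsWarpingFunction (a : ℝ) (f : ℝ → ℝ) : Prop where
  pos_length : 0 < a
  smooth : ContDiffOn ℝ ∞ f (Icc 0 a)
  pos : ∀ t ∈ Ioo 0 a, 0 < f t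
  left_end : f 0 = 0
  right_end : f a = 0

/-- The part `(0, a) × S^d` of `[0, a] ×_f S^d` away from the two poles, an open subset of the
cylinder on which `warpedMetric d f` is a Riemannian metric. -/
def regularPart (d : ℕ) (a : ℝ) : Set (ℝ × Sph d) := Ioo 0 a ×ˢ univ

/-- The volume of `[0, a] ×_f S^d`, with metric `dt² + f(t)² dσ²`; the two poles carry none. -/
def warpedVolume (d : ℕ) (a : ℝ) (f : ℝ → ℝ) : ℝ≥0∞ :=
  riemannianVolume (cylModel d) (cylBasis d) (warpedMetric d f) (regularPart d a)

end Warped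

end WarpedFootball

end

/-!
Write `d = n - 1`, so that the metric is `dt² + f² dσ²` on `(0, a) × S^d` with `d ≥ 2`.

In the chart of the cylinder given by stereographic projection the metric is diagonal, with entries
`1` and `(f (t) * conf y) ^ 2`, where `conf y = 4 / (|y|² + 4)`. At the centre `y = 0` of the chart
this gives `Ric(∂t, ∂t) = -d f'' / f` (`exists_unit_axial_vector`) and the scalar curvature
(`scalarCurvature_warped`). The two curvature hypotheses become
`ε f ≤ -f''` and `(d + 1) f² ≤ -2 f f'' + (d - 1) (1 - f'²)`.

The comparison is then one-dimensional. The function `f` rises to a maximum `A` at some `T` and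
falls again, and by reflection it suffices to treat the rising half. There `f'² + ε f²` decreases,
so `f'² ≥ ε (A² - f²)`, and the mass `f ^ (d - 1) (1 - f'² - f²)` increases from `0`. This gives
`A ≤ 1` and a second lower bound on `f'²`. In terms of the angle `θ = arcsin (f / A)` and of
`λ = (1 - A²) / A²` the two bounds read `θ'² ≥ max ε (1 - λ q)`, with
`q = (s ^ (1 - d) - 1) / (1 - s²)` and `s = sin θ`. Hence, if `ε = 4 / (C + 1) ^ 2`,
`dt ≤ (1 + C λ q / 2) dθ`, and `∫ f ^ d dt ≤ A ^ d (I + C λ J / 2)` with `I` and `J` the integrals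
of `sin θ ^ d` and `q sin θ ^ d` over `[0, π / 2]`. An explicit primitive shows `J = d I - 1 < d I`
(`integral_excess_sin`), so some `C > 1` has `C J ≤ d I`, and then Bernoulli's inequality
`1 + d λ / 2 ≤ (1 + λ) ^ (d / 2) = A ^ (-d)` bounds the right hand side by `I`
(`RisingProfile.integral_le`). Only the Ricci curvature in the direction `∂t` matters.

For the volumes, the cone measure `volume.toSphere` on `S^d` dominates the Riemannian measure of
every stereographic chart: the map `(r, y) ↦ r • sphParam x y` has Jacobian `(r conf y) ^ d`
(`map_symm_le_toSphere`). Hence the volume of the warped product is at most `∫ f ^ d` times the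
total cone measure. A single chart of `S^(d+1)` already has volume `∫ conf y ^ (d + 1) dy`, which in polar
coordinates, with the polar angle `2 arctan (|y| / 2)`, is `∫_0^π sin θ ^ d` times the same constant
(`lintegral_conf_pow`).
-/

namespace WarpedFootball

/-! ### The excess integral -/

/-- First order coefficient `s (1 + s + ⋯ + s ^ (k - 1)) / (1 + s) = s (1 - s ^ k) / (1 - s ^ 2)`
of the excess volume element. It is used for `s ∈ [0, 1]` only; the absolute value in
the denominator makes it continuous on the whole line. -/
noncomputable def excess (k : ℕ) (s : ℝ) : ℝ := s * (∑ j ∈ Finset.range k, s ^ j) / (1 + |s|)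

lemma continuous_excess (k : ℕ) : Continuous (excess k) := by
  unfold excess
  refine Continuous.div (by fun_prop) (by fun_prop) fun s => ?_
  positivity

/-- The difference `(k + 1) sin θ ^ k - excess (k + 1) (sin θ)` is the derivative of
`-cos θ (1 + sin θ + ⋯ + sin θ ^ k) / (1 + sin θ)`; the reduction formula for powers of the sine
turns `(k + 1) ∫ sin θ ^ k` into `(k + 2) ∫ sin θ ^ (k + 2)`. -/
lemma integral_excess_sin (k : ℕ) :
    ∫ θ in (0 : ℝ)..(Real.pi / 2), excess (k + 1) (Real.sin θ)
      = (k + 2) * (∫ θ in (0 : ℝ)..(Real.pi / 2), Real.sin θ ^ (k + 2)) - 1 := by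
  have hpi := Real.pi_pos
  set S : ℝ → ℝ := fun s => ∑ j ∈ Finset.range (k + 1), s ^ j with hS
  have hgeom : ∀ s : ℝ, (1 - s) * S s = 1 - s ^ (k + 1) := fun s => mul_neg_geom_sum s (k + 1)
  have hSd : ∀ s : ℝ, HasDerivAt S (deriv S s) s := fun s =>
    DifferentiableAt.hasDerivAt (by simp only [hS]; fun_prop)
  -- Differentiating `hgeom` gives the derivative of `S` in a form that needs no explicit sum.
  have hS' : ∀ s : ℝ, (1 - s) * deriv S s = S s - (k + 1) * s ^ k := by
    intro s
    have h1 : HasDerivAt (fun s => (1 - s) * S s) (-1 * S s + (1 - s) * deriv S s) s :=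
      ((hasDerivAt_id s).const_sub 1).mul (hSd s)
    have h2 : HasDerivAt (fun s : ℝ => 1 - s ^ (k + 1)) (-(((k + 1 : ℕ) : ℝ) * s ^ k)) s := by
      simpa using (hasDerivAt_pow (k + 1) s).const_sub 1
    have h3 := h1.unique ((funext hgeom) ▸ h2)
    push_cast at h3
    linarith
  have hsin : ∀ θ ∈ uIcc 0 (Real.pi / 2), 0 ≤ Real.sin θ := by
    intro θ hθ
    rw [uIcc_of_le (by positivity)] at hθ
    exact Real.sin_nonneg_of_nonneg_of_le_pi hθ.1 (by linarith [hθ.2])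
  have hderiv : ∀ θ ∈ uIcc 0 (Real.pi / 2),
      HasDerivAt (fun θ => -(Real.cos θ * (S (Real.sin θ) / (1 + Real.sin θ))))
        ((k + 1) * Real.sin θ ^ k - excess (k + 1) (Real.sin θ)) θ := by
    intro θ hθ
    have h0 := hsin θ hθ
    have hne : (1 : ℝ) + Real.sin θ ≠ 0 := by positivity
    have h1 : HasDerivAt (fun θ => S (Real.sin θ)) (deriv S (Real.sin θ) * Real.cos θ) θ :=
      (hSd _).comp θ (Real.hasDerivAt_sin θ)
    have h2 := ((Real.hasDerivAt_cos θ).mul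
      (h1.div ((Real.hasDerivAt_sin θ).const_add 1) hne)).neg
    refine h2.congr_deriv ?_
    have hc := Real.cos_sq' θ
    have hs' := hS' (Real.sin θ)
    rw [excess, abs_of_nonneg h0]
    simp only [Pi.div_apply]
    change _ = (k + 1) * Real.sin θ ^ k - Real.sin θ * S (Real.sin θ) / (1 + Real.sin θ)
    field_simp
    generalize Real.sin θ = s at *
    generalize Real.cos θ = c at *
    linear_combination (-(deriv S s * (1 + s) - S s)) * hc - (1 + s) ^ 2 * hs'
  have hcont1 : Continuous fun θ => ((k : ℝ) + 1) * Real.sin θ ^ k := by fun_prop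
  have hcont2 : Continuous fun θ => excess (k + 1) (Real.sin θ) :=
    (continuous_excess _).comp Real.continuous_sin
  have h := intervalIntegral.integral_eq_sub_of_hasDerivAt hderiv
    ((hcont1.sub hcont2).intervalIntegrable _ _)
  rw [intervalIntegral.integral_sub (hcont1.intervalIntegrable _ _)
    (hcont2.intervalIntegrable _ _), intervalIntegral.integral_const_mul] at h
  have hS0 : S 0 = 1 := by simp [hS, Finset.sum_range_succ']
  have hI := integral_sin_pow (a := 0) (b := Real.pi / 2) k
  simp [hS0] at h hI
  have hk : (k : ℝ) + 2 ≠ 0 := by positivity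
  rw [hI]
  field_simp
  linarith

/-- The strict inequality between the two integrals leaves room for a factor `C > 1`; the constant
`ε` of the comparison theorem is `4 / (C + 1) ^ 2`. -/
lemma exists_constant_for_excess (k : ℕ) : ∃ C : ℝ, 1 < C ∧
    C * (∫ θ in (0 : ℝ)..(Real.pi / 2), excess (k + 1) (Real.sin θ))
      ≤ (k + 2) * ∫ θ in (0 : ℝ)..(Real.pi / 2), Real.sin θ ^ (k + 2) := by
  rw [integral_excess_sin]
  set K := ((k : ℝ) + 2) * ∫ θ in (0 : ℝ)..(Real.pi / 2), Real.sin θ ^ (k + 2) with hK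
  have hK0 : 0 ≤ K := by
    refine mul_nonneg (by positivity) (intervalIntegral.integral_nonneg (by positivity) ?_)
    intro θ hθ
    exact pow_nonneg (Real.sin_nonneg_of_nonneg_of_le_pi hθ.1
      (by linarith [hθ.2, Real.pi_pos])) _
  by_cases h : K ≤ 1
  · exact ⟨2, by norm_num, by linarith⟩
  · push Not at h
    refine ⟨K / (K - 1), ?_, ?_⟩
    · rw [lt_div_iff₀ (by linarith)]; linarith
    · rw [div_mul_cancel₀ _ (by linarith)]

/-! ### The one-dimensional comparison -/

/-- Bernoulli's inequality `1 + r y ≤ (1 + y) ^ r` for `y = x ^ 2 - 1` and the half-integer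
exponent `r = (m + 2) / 2`. -/
lemma bernoulli_sq {x : ℝ} (hx : 1 ≤ x) (m : ℕ) :
    1 + ((m : ℝ) + 2) / 2 * (x ^ 2 - 1) ≤ x ^ (m + 2) := by
  induction m with
  | zero => simp
  | succ m ih =>
    have h1 : x * (1 + ((m : ℝ) + 2) / 2 * (x ^ 2 - 1)) ≤ x * x ^ (m + 2) :=
      mul_le_mul_of_nonneg_left ih (by linarith)
    have hm : (0 : ℝ) ≤ m := m.cast_nonneg
    have h2 : 0 ≤ (x - 1) ^ 2 * (x + 1) * m := by
      have : 0 ≤ x + 1 := by linarith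
      positivity
    have h3 : 0 ≤ (x - 1) ^ 2 * (2 * x + 1) := by
      have : 0 ≤ 2 * x + 1 := by linarith
      positivity
    calc _ ≤ x * (1 + ((m : ℝ) + 2) / 2 * (x ^ 2 - 1)) := by push_cast; nlinarith
      _ ≤ x * x ^ (m + 2) := h1
      _ = _ := by ring

/-- Elementary form of the inequality `m ^ (-1/2) ≤ 1 + C z / 2` for
`m ≥ max (4 / (C + 1) ^ 2) (1 - z)`. -/
lemma one_le_mul_of_lower_bounds {C z m τ : ℝ} (hC : 1 < C) (hz : 0 ≤ z)
    (h1 : 4 / (C + 1) ^ 2 ≤ m) (h2 : 1 - z ≤ m) (hτ : 0 ≤ τ) (hm : m ≤ τ ^ 2) :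
    1 ≤ τ * (1 + C / 2 * z) := by
  have hpos : 0 ≤ 1 + C / 2 * z := by positivity
  suffices h : 1 ≤ m * (1 + C / 2 * z) ^ 2 by
    have : 1 ^ 2 ≤ (τ * (1 + C / 2 * z)) ^ 2 := by
      rw [mul_pow, one_pow]
      exact h.trans (mul_le_mul_of_nonneg_right hm (sq_nonneg _))
    exact (pow_le_pow_iff_left₀ zero_le_one (by positivity) two_ne_zero).1 this
  -- The lower bound `1 - z` on `m` is used up to `z = 1 - 1 / C`, the constant one beyond.
  rcases le_total (C * z) (C - 1) with h | h
  · have hz1 : 0 ≤ 1 - z := by nlinarith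
    calc (1 : ℝ) ≤ (1 - z) * (1 + C * z) := by nlinarith
      _ ≤ (1 - z) * (1 + C / 2 * z) ^ 2 := by gcongr; nlinarith [sq_nonneg (C * z)]
      _ ≤ _ := by gcongr
  · calc (1 : ℝ) = 4 / (C + 1) ^ 2 * ((C + 1) / 2) ^ 2 := by
          have : C + 1 ≠ 0 := by linarith
          field_simp; norm_num
      _ ≤ m * (1 + C / 2 * z) ^ 2 := by
          have : 0 ≤ m := le_trans (by positivity) h1
          gcongr
          linarith

/-- A rising half of a warping profile, from the pole, where it vanishes, to its maximum at `T`,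
with the two differential inequalities that express `Ric(∂t, ∂t) ≥ ε d` and `R ≥ d (d + 1)` for
`d = k + 2`. Here `p` and `q` are the first two derivatives of `f`. -/
structure RisingProfile (k : ℕ) (ε T : ℝ) (f p q : ℝ → ℝ) : Prop where
  length_pos : 0 < T
  cont : ContinuousOn f (Icc 0 T)
  cont_deriv : ContinuousOn p (Icc 0 T)
  hasDeriv : ∀ t ∈ Ioo 0 T, HasDerivAt f (p t) t
  hasDeriv_deriv : ∀ t ∈ Ioo 0 T, HasDerivAt p (q t) t
  start : f 0 = 0
  deriv_pos : ∀ t ∈ Ioo 0 T, 0 < p t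
  deriv_end : p T = 0
  radial : ∀ t ∈ Ioo 0 T, ε * f t ≤ -q t
  scalar : ∀ t ∈ Ioo 0 T,
    ((k : ℝ) + 3) * f t ^ 2 ≤ -2 * f t * q t + ((k : ℝ) + 1) * (1 - p t ^ 2)

namespace RisingProfile

variable {k : ℕ} {ε T : ℝ} {f p q : ℝ → ℝ}

lemma strictMonoOn (h : RisingProfile k ε T f p q) : StrictMonoOn f (Icc 0 T) := by
  refine strictMonoOn_of_deriv_pos (convex_Icc 0 T) h.cont fun t ht => ?_
  rw [interior_Icc] at ht
  rw [(h.hasDeriv t ht).deriv]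
  exact h.deriv_pos t ht

lemma pos (h : RisingProfile k ε T f p q) {t : ℝ} (ht : t ∈ Ioc 0 T) : 0 < f t := by
  have := h.strictMonoOn ⟨le_rfl, h.length_pos.le⟩ ⟨ht.1.le, ht.2⟩ ht.1
  rwa [h.start] at this

/-- The function `p ^ 2 + ε * f ^ 2` decreases, and `p` vanishes at `T`. -/
lemma radial_bound (h : RisingProfile k ε T f p q) {t : ℝ} (ht : t ∈ Icc 0 T) :
    ε * (f T ^ 2 - f t ^ 2) ≤ p t ^ 2 := by
  have hanti : AntitoneOn (fun t => p t ^ 2 + ε * f t ^ 2) (Icc 0 T) := by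
    refine antitoneOn_of_hasDerivWithinAt_nonpos (convex_Icc 0 T)
      ((h.cont_deriv.pow 2).add (continuousOn_const.mul (h.cont.pow 2)))
      (f' := fun t => 2 * p t * (q t + ε * f t)) ?_ ?_
    · intro t ht
      rw [interior_Icc] at ht
      refine HasDerivAt.hasDerivWithinAt ?_
      refine (((h.hasDeriv_deriv t ht).pow 2).add
        (((h.hasDeriv t ht).pow 2).const_mul ε)).congr_deriv ?_
      simp; ring
    · intro t ht
      rw [interior_Icc] at ht
      have h1 := h.deriv_pos t ht
      have h2 := h.radial t ht
      nlinarith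
  have := hanti ht ⟨h.length_pos.le, le_rfl⟩ ht.2
  simp only [h.deriv_end] at this
  linarith

/-- Monotonicity of the mass function `f ^ (d - 1) (1 - f' ^ 2 - f ^ 2)`, which is what the lower
bound on the scalar curvature amounts to. -/
lemma monotoneOn_mass (h : RisingProfile k ε T f p q) :
    MonotoneOn (fun t => f t ^ (k + 1) * (1 - p t ^ 2 - f t ^ 2)) (Icc 0 T) := by
  refine monotoneOn_of_hasDerivWithinAt_nonneg (convex_Icc 0 T)
    ((h.cont.pow _).mul ((continuousOn_const.sub (h.cont_deriv.pow 2)).sub (h.cont.pow 2)))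
    (f' := fun t => f t ^ k * p t *
      (-2 * f t * q t + (k + 1) * (1 - p t ^ 2) - (k + 3) * f t ^ 2)) ?_ ?_
  · intro t ht
    rw [interior_Icc] at ht
    refine HasDerivAt.hasDerivWithinAt ?_
    refine (((h.hasDeriv t ht).pow (k + 1)).mul ((((h.hasDeriv_deriv t ht).pow 2).const_sub 1).sub
      ((h.hasDeriv t ht).pow 2))).congr_deriv ?_
    simp; ring
  · intro t ht
    rw [interior_Icc] at ht
    have h1 := h.deriv_pos t ht
    have h2 := h.scalar t ht
    have h3 := h.pos ⟨ht.1, ht.2.le⟩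
    exact mul_nonneg (by positivity) (by linarith)

/-- The mass function vanishes at the pole, where `p` is bounded, so that it is
nonnegative at `T`. -/
lemma max_le_one (h : RisingProfile k ε T f p q) : f T ≤ 1 := by
  have h0 := h.length_pos.le
  have h1 := h.monotoneOn_mass ⟨le_rfl, h0⟩ ⟨h0, le_rfl⟩ h0
  have hA := h.pos ⟨h.length_pos, le_rfl⟩
  simp only [h.start, h.deriv_end] at h1
  have h2 : 0 ≤ 1 - f T ^ 2 := by
    have : 0 < f T ^ (k + 1) := by positivity
    by_contra hneg
    push Not at hneg
    have := mul_neg_of_pos_of_neg this hneg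
    simp at h1
    linarith
  nlinarith

lemma scalar_bound (h : RisingProfile k ε T f p q) {t : ℝ} (ht : t ∈ Icc 0 T) :
    f t ^ (k + 1) * (1 - p t ^ 2 - f t ^ 2) ≤ f T ^ (k + 1) * (1 - f T ^ 2) := by
  have := h.monotoneOn_mass ht ⟨h.length_pos.le, le_rfl⟩ ht.2
  simpa [h.deriv_end] using this

/-- In terms of the angle `θ = arcsin (f / f T)` the volume element `f ^ d dt` is at most
`sin θ ^ d dθ` plus a multiple of `excess (sin θ) dθ`. -/
lemma pow_le_angle_speed {C : ℝ} (hC : 1 < C) (hε : ε = 4 / (C + 1) ^ 2)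
    (h : RisingProfile k ε T f p q) {t : ℝ} (ht : t ∈ Ioo 0 T) :
    (f t / f T) ^ (k + 2) ≤
      ((f t / f T) ^ (k + 2)
        + C / 2 * ((1 - f T ^ 2) / f T ^ 2) * excess (k + 1) (f t / f T)) *
      (1 / √(1 - (f t / f T) ^ 2) * (p t / f T)) := by
  have hA := h.pos ⟨h.length_pos, le_rfl⟩
  have hft := h.pos ⟨ht.1, ht.2.le⟩
  have hlt : f t < f T := h.strictMonoOn ⟨ht.1.le, ht.2.le⟩ ⟨h.length_pos.le, le_rfl⟩ ht.2
  have hp := h.deriv_pos t ht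
  have hrad := h.radial_bound ⟨ht.1.le, ht.2.le⟩
  have hsc := h.scalar_bound ⟨ht.1.le, ht.2.le⟩
  have hA1 := h.max_le_one
  set A := f T
  obtain ⟨s, hs⟩ : ∃ s, s = f t / A := ⟨_, rfl⟩
  have hfs : f t = A * s := by rw [hs]; field_simp
  rw [← hs]
  have hs0 : 0 < s := by rw [hs]; positivity
  have hs1 : s < 1 := by rw [hs, div_lt_one hA]; exact hlt
  have hss : 0 < 1 - s ^ 2 := by nlinarith
  set S := ∑ j ∈ Finset.range (k + 1), s ^ j with hS
  have hSpos : 0 ≤ S := Finset.sum_nonneg fun j _ => by positivity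
  have hgeom : (1 - s) * S = 1 - s ^ (k + 1) := mul_neg_geom_sum s (k + 1)
  have hlam : 0 ≤ (1 - A ^ 2) / A ^ 2 := div_nonneg (by nlinarith) (by positivity)
  set z := (1 - A ^ 2) / A ^ 2 * (S / ((1 + s) * s ^ (k + 1))) with hz
  have hz0 : 0 ≤ z :=
    mul_nonneg hlam (div_nonneg hSpos (mul_nonneg (by linarith) (pow_nonneg hs0.le _)))
  -- `τ` is the derivative of the angle `arcsin (f / A)`.
  set τ := 1 / √(1 - s ^ 2) * (p t / A) with hτ
  have hτ2 : τ ^ 2 = p t ^ 2 / (A ^ 2 * (1 - s ^ 2)) := by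
    rw [hτ, mul_pow, div_pow, div_pow, Real.sq_sqrt hss.le]; field_simp
  have key : 1 ≤ τ * (1 + C / 2 * z) := by
    refine one_le_mul_of_lower_bounds (m := τ ^ 2) hC hz0 ?_ ?_ (by positivity) le_rfl
    · rw [← hε, hτ2, le_div_iff₀ (by positivity)]
      rw [hfs] at hrad
      linarith
    · rw [hτ2, le_div_iff₀ (by positivity)]
      rw [hfs, mul_pow] at hsc
      have hAk : 0 < A ^ (k + 1) := by positivity
      have hsk : 0 < s ^ (k + 1) := by positivity
      have h1 : s ^ (k + 1) * (1 - p t ^ 2 - (A * s) ^ 2) ≤ 1 - A ^ 2 := by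
        have : A ^ (k + 1) * (s ^ (k + 1) * (1 - p t ^ 2 - (A * s) ^ 2))
          ≤ A ^ (k + 1) * (1 - A ^ 2) := by rw [← mul_assoc]; exact hsc
        exact le_of_mul_le_mul_left this hAk
      have h2 : z * (A ^ 2 * (1 - s ^ 2)) * s ^ (k + 1) = (1 - A ^ 2) * (1 - s ^ (k + 1)) := by
        rw [hz, ← hgeom]
        field_simp
        ring
      refine le_of_mul_le_mul_right ?_ hsk
      linarith
  have hex : (1 - A ^ 2) / A ^ 2 * excess (k + 1) s = s ^ (k + 2) * z := by
    rw [excess, abs_of_pos hs0, hz, ← hS]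
    field_simp
    ring
  calc s ^ (k + 2) = s ^ (k + 2) * 1 := by ring
    _ ≤ s ^ (k + 2) * (τ * (1 + C / 2 * z)) := by gcongr
    _ = (s ^ (k + 2) + C / 2 * (s ^ (k + 2) * z)) * τ := by ring
    _ = _ := by rw [← hex]; ring

/-- Comparison of the volume of a rising half with that of a hemisphere. -/
lemma integral_le {C : ℝ} (hC : 1 < C) (hε : ε = 4 / (C + 1) ^ 2)
    (hCk : C * (∫ θ in (0 : ℝ)..(Real.pi / 2), excess (k + 1) (Real.sin θ))
      ≤ (k + 2) * ∫ θ in (0 : ℝ)..(Real.pi / 2), Real.sin θ ^ (k + 2))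
    (h : RisingProfile k ε T f p q) :
    ∫ t in (0 : ℝ)..T, f t ^ (k + 2) ≤ ∫ θ in (0 : ℝ)..(Real.pi / 2), Real.sin θ ^ (k + 2) := by
  have hA := h.pos ⟨h.length_pos, le_rfl⟩
  have hA1 := h.max_le_one
  have hT := h.length_pos
  set A := f T with hAdef
  set lam := (1 - A ^ 2) / A ^ 2 with hlam
  have hlam0 : 0 ≤ lam := div_nonneg (by nlinarith) (by positivity)
  set g : ℝ → ℝ := fun θ => Real.sin θ ^ (k + 2) + C / 2 * lam * excess (k + 1) (Real.sin θ) with hg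
  have hexc : Continuous fun θ => excess (k + 1) (Real.sin θ) :=
    (continuous_excess _).comp Real.continuous_sin
  have hgc : Continuous g := by simp only [hg]; fun_prop
  set G : ℝ → ℝ := fun θ => ∫ φ in (0 : ℝ)..θ, g φ with hG
  have hGd : ∀ θ, HasDerivAt G (g θ) θ := fun θ =>
    intervalIntegral.integral_hasDerivAt_right (hgc.intervalIntegrable _ _)
      (hgc.stronglyMeasurableAtFilter _ _) hgc.continuousAt
  have hGc : Continuous G := continuous_iff_continuousAt.2 fun θ => (hGd θ).continuousAt
  have hsc : ContinuousOn (fun t => (f t / A) ^ (k + 2)) (Icc 0 T) := (h.cont.div_const A).pow _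
  have hmono : MonotoneOn (fun t => G (Real.arcsin (f t / A))
      - ∫ r in (0 : ℝ)..t, (f r / A) ^ (k + 2)) (Icc 0 T) := by
    refine monotoneOn_of_hasDerivWithinAt_nonneg (convex_Icc 0 T) (f' := fun t =>
      g (Real.arcsin (f t / A)) * (1 / √(1 - (f t / A) ^ 2) * (p t / A))
        - (f t / A) ^ (k + 2)) ?_ ?_ ?_
    · refine ContinuousOn.sub ?_ ?_
      · exact (hGc.comp Real.continuous_arcsin).comp_continuousOn (h.cont.div_const A)
      · have := intervalIntegral.continuousOn_primitive_interval (μ := volume)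
          (f := fun t => (f t / A) ^ (k + 2)) (a := 0) (b := T)
          (by rw [uIcc_of_le hT.le]; exact hsc.integrableOn_Icc)
        rwa [uIcc_of_le hT.le] at this
    · intro t ht
      rw [interior_Icc] at ht
      have hft := h.pos ⟨ht.1, ht.2.le⟩
      have hlt : f t < A := h.strictMonoOn ⟨ht.1.le, ht.2.le⟩ ⟨h.length_pos.le, le_rfl⟩ ht.2
      have hs0 : 0 < f t / A := by positivity
      have hs1 : f t / A < 1 := by rwa [div_lt_one hA]
      refine (HasDerivAt.sub ?_ ?_).hasDerivWithinAt
      · have h1 := (Real.hasDerivAt_arcsin (by linarith) hs1.ne).comp t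
          ((h.hasDeriv t ht).div_const A)
        exact (hGd _).comp t h1
      · have hint : IntervalIntegrable (fun t => (f t / A) ^ (k + 2)) volume 0 t := by
          refine ContinuousOn.intervalIntegrable ?_
          rw [uIcc_of_le ht.1.le]
          exact hsc.mono (Icc_subset_Icc_right ht.2.le)
        refine intervalIntegral.integral_hasDerivAt_right hint ?_ ?_
        · exact ContinuousOn.stronglyMeasurableAtFilter isOpen_Ioo
            (hsc.mono Ioo_subset_Icc_self) t ht
        · exact hsc.continuousAt (Icc_mem_nhds ht.1 ht.2)
    · intro t ht
      rw [interior_Icc] at ht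
      have hft := h.pos ⟨ht.1, ht.2.le⟩
      have hlt : f t < A := h.strictMonoOn ⟨ht.1.le, ht.2.le⟩ ⟨h.length_pos.le, le_rfl⟩ ht.2
      have hs0 : 0 < f t / A := by positivity
      have hs1 : f t / A < 1 := by rwa [div_lt_one hA]
      have := h.pow_le_angle_speed hC hε ht
      rw [sub_nonneg]
      simp only [hg]
      rw [Real.sin_arcsin (by linarith) hs1.le]
      exact this
  have hend := hmono ⟨le_rfl, hT.le⟩ ⟨hT.le, le_rfl⟩ hT.le
  simp only [h.start, zero_div, Real.arcsin_zero, intervalIntegral.integral_same, ← hAdef,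
    div_self hA.ne', Real.arcsin_one] at hend
  have hG0 : G 0 = 0 := by simp [hG]
  have hGpi : G (Real.pi / 2) = (∫ θ in (0 : ℝ)..(Real.pi / 2), Real.sin θ ^ (k + 2))
      + C / 2 * lam * ∫ θ in (0 : ℝ)..(Real.pi / 2), excess (k + 1) (Real.sin θ) := by
    simp only [hG, hg]
    rw [intervalIntegral.integral_add (by apply Continuous.intervalIntegrable; fun_prop)
      (by apply Continuous.intervalIntegrable; fun_prop), intervalIntegral.integral_const_mul]
  rw [hG0, hGpi] at hend
  set I := ∫ θ in (0 : ℝ)..(Real.pi / 2), Real.sin θ ^ (k + 2) with hI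
  set J := ∫ θ in (0 : ℝ)..(Real.pi / 2), excess (k + 1) (Real.sin θ)
  have hI0 : 0 ≤ I := intervalIntegral.integral_nonneg (by positivity) fun θ hθ =>
    pow_nonneg (Real.sin_nonneg_of_nonneg_of_le_pi hθ.1 (by linarith [hθ.2, Real.pi_pos])) _
  have h1 : ∫ r in (0 : ℝ)..T, (f r / A) ^ (k + 2) ≤ (1 + (k + 2) / 2 * lam) * I := by
    have : lam / 2 * (C * J) ≤ lam / 2 * ((k + 2) * I) := by gcongr
    linarith
  have h2 : ∫ r in (0 : ℝ)..T, f r ^ (k + 2)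
      = A ^ (k + 2) * ∫ r in (0 : ℝ)..T, (f r / A) ^ (k + 2) := by
    rw [← intervalIntegral.integral_const_mul]
    congr 1
    ext r
    rw [← mul_pow, mul_div_cancel₀ _ hA.ne']
  have h3 : A ^ (k + 2) * (1 + (k + 2) / 2 * lam) ≤ 1 := by
    have hb := bernoulli_sq (x := 1 / A) (by rw [le_div_iff₀ hA]; linarith) k
    have hl : (1 / A) ^ 2 - 1 = lam := by rw [hlam]; field_simp
    rw [hl] at hb
    calc _ ≤ A ^ (k + 2) * (1 / A) ^ (k + 2) := by gcongr
      _ = 1 := by rw [← mul_pow, mul_one_div_cancel hA.ne', one_pow]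
  rw [h2]
  calc _ ≤ A ^ (k + 2) * ((1 + (k + 2) / 2 * lam) * I) := by gcongr
    _ = (A ^ (k + 2) * (1 + (k + 2) / 2 * lam)) * I := by ring
    _ ≤ 1 * I := by gcongr
    _ = I := one_mul I

end RisingProfile


/-! ### Splitting a warping function at its maximum -/

lemma integral_sin_pow_half (m : ℕ) :
    ∫ θ in (0 : ℝ)..Real.pi, Real.sin θ ^ m
      = 2 * ∫ θ in (0 : ℝ)..(Real.pi / 2), Real.sin θ ^ m := by
  have hc : Continuous fun θ => Real.sin θ ^ m := by fun_prop
  rw [← intervalIntegral.integral_add_adjacent_intervals (b := Real.pi / 2)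
    (hc.intervalIntegrable _ _) (hc.intervalIntegrable _ _)]
  have := intervalIntegral.integral_comp_sub_left (fun θ => Real.sin θ ^ m)
    (a := 0) (b := Real.pi / 2) Real.pi
  simp only [Real.sin_pi_sub, sub_zero] at this
  rw [this, show Real.pi - Real.pi / 2 = Real.pi / 2 by ring]
  ring

/-- Both the part of `f` up to its maximum and the reflected part beyond it are rising profiles. -/
lemma exists_risingProfile {k : ℕ} {ε a : ℝ} {f : ℝ → ℝ} (hε : 0 < ε) (hf : IsWarpingFunction a f)
    (hrad : ∀ t ∈ Ioo 0 a, ε * f t ≤ -deriv (deriv f) t)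
    (hsc : ∀ t ∈ Ioo 0 a, ((k : ℝ) + 3) * f t ^ 2 ≤
      -2 * f t * deriv (deriv f) t + ((k : ℝ) + 1) * (1 - deriv f t ^ 2)) :
    ∃ T ∈ Ioo 0 a, (∃ p q, RisingProfile k ε T f p q) ∧
      ∃ p q, RisingProfile k ε (a - T) (fun t => f (a - t)) p q := by
  have ha := hf.pos_length
  have hcont : ContinuousOn f (Icc 0 a) := hf.smooth.continuousOn
  -- The one-sided derivative is continuous up to the poles, which `deriv f` need not be.
  set p := derivWithin f (Icc 0 a) with hp
  have hpsmooth : ContDiffOn ℝ 1 p (Icc 0 a) :=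
    ContDiffOn.derivWithin hf.smooth (uniqueDiffOn_Icc ha)
      (by norm_num; exact WithTop.coe_le_coe.2 le_top)
  have hpc : ContinuousOn p (Icc 0 a) := hpsmooth.continuousOn
  have hpd : ∀ t ∈ Ioo 0 a, p t = deriv f t := fun t ht =>
    derivWithin_of_mem_nhds (Icc_mem_nhds ht.1 ht.2)
  have hfd : ∀ t ∈ Ioo 0 a, HasDerivAt f (p t) t := fun t ht => by
    rw [hpd t ht]
    exact ((hf.smooth.differentiableOn (by simp)).differentiableAt
      (Icc_mem_nhds ht.1 ht.2)).hasDerivAt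
  have hpd2 : ∀ t ∈ Ioo 0 a, HasDerivAt p (deriv (deriv f) t) t := fun t ht => by
    have h1 : p =ᶠ[nhds t] deriv f :=
      Filter.eventually_of_mem (Ioo_mem_nhds ht.1 ht.2) hpd
    rw [← h1.deriv_eq]
    exact ((hpsmooth.differentiableOn one_ne_zero).differentiableAt
      (Icc_mem_nhds ht.1 ht.2)).hasDerivAt
  have hanti : StrictAntiOn p (Icc 0 a) := by
    refine strictAntiOn_of_deriv_neg (convex_Icc 0 a) hpc fun t ht => ?_
    rw [interior_Icc] at ht
    rw [(hpd2 t ht).deriv]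
    have := hrad t ht
    have := mul_pos hε (hf.pos t ht)
    linarith
  obtain ⟨T, hT, hmax⟩ := isCompact_Icc.exists_isMaxOn (nonempty_Icc.2 ha.le) hcont
  have hmid : a / 2 ∈ Ioo 0 a := ⟨by linarith, by linarith⟩
  have hfT : 0 < f T := (hf.pos _ hmid).trans_le (hmax ⟨hmid.1.le, hmid.2.le⟩)
  have hTo : T ∈ Ioo 0 a := by
    refine ⟨lt_of_le_of_ne hT.1 ?_, lt_of_le_of_ne hT.2 ?_⟩
    · rintro rfl; rw [hf.left_end] at hfT; exact lt_irrefl _ hfT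
    · rintro rfl; rw [hf.right_end] at hfT; exact lt_irrefl _ hfT
  have hpT : p T = 0 := by
    rw [hpd T hTo]
    exact (hmax.isLocalMax (Icc_mem_nhds hTo.1 hTo.2)).deriv_eq_zero
  refine ⟨T, hTo, ⟨p, deriv (deriv f), ?_⟩,
    ⟨fun t => -p (a - t), fun t => deriv (deriv f) (a - t), ?_⟩⟩
  · have hsub : ∀ t ∈ Ioo 0 T, t ∈ Ioo 0 a := fun t ht => ⟨ht.1, ht.2.trans hTo.2⟩
    exact
      { length_pos := hTo.1
        cont := hcont.mono (Icc_subset_Icc_right hT.2)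
        cont_deriv := hpc.mono (Icc_subset_Icc_right hT.2)
        hasDeriv := fun t ht => hfd t (hsub t ht)
        hasDeriv_deriv := fun t ht => hpd2 t (hsub t ht)
        start := hf.left_end
        deriv_pos := fun t ht => by
          rw [← hpT]
          exact hanti ⟨ht.1.le, (hsub t ht).2.le⟩ hT ht.2
        deriv_end := hpT
        radial := fun t ht => hrad t (hsub t ht)
        scalar := fun t ht => by rw [hpd t (hsub t ht)]; exact hsc t (hsub t ht) }
  · have hsub : ∀ t ∈ Ioo 0 (a - T), a - t ∈ Ioo 0 a := fun t ht =>
      ⟨by linarith [ht.2, hTo.1], by linarith [ht.1]⟩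
    have hmaps : MapsTo (fun t => a - t) (Icc 0 (a - T)) (Icc 0 a) := fun t ht =>
      ⟨by linarith [ht.2, hTo.1], by linarith [ht.1]⟩
    have hrefl : ContinuousOn (fun t : ℝ => a - t) (Icc 0 (a - T)) := by fun_prop
    have hd : ∀ t : ℝ, HasDerivAt (fun t : ℝ => a - t) (-1) t := fun t => by
      simpa using (hasDerivAt_id t).const_sub a
    exact
      { length_pos := by linarith [hTo.2]
        cont := hcont.comp hrefl hmaps
        cont_deriv := (hpc.comp hrefl hmaps).neg
        hasDeriv := fun t ht =>
          ((hfd _ (hsub t ht)).comp t (hd t)).congr_deriv (by ring)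
        hasDeriv_deriv := fun t ht =>
          ((hpd2 _ (hsub t ht)).comp t (hd t)).neg.congr_deriv (by ring)
        start := by simpa using hf.right_end
        deriv_pos := fun t ht => by
          have := hanti hT (Ioo_subset_Icc_self (hsub t ht)) (by linarith [ht.2] : T < a - t)
          change 0 < -p (a - t)
          linarith
        deriv_end := by simp [hpT]
        radial := fun t ht => hrad _ (hsub t ht)
        scalar := fun t ht => by
          simp only [neg_sq]
          rw [hpd _ (hsub t ht)]; exact hsc _ (hsub t ht) }

/-- The comparison theorem in terms of the warping function alone, for spheres of dimension
`k + 3`. -/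
lemma exists_constant_forall_integral_le (k : ℕ) : ∃ ε : ℝ, 0 < ε ∧ ε < 1 ∧
    ∀ (a : ℝ) (f : ℝ → ℝ), IsWarpingFunction a f →
      (∀ t ∈ Ioo 0 a, ε * f t ≤ -deriv (deriv f) t) →
      (∀ t ∈ Ioo 0 a, ((k : ℝ) + 3) * f t ^ 2 ≤
        -2 * f t * deriv (deriv f) t + ((k : ℝ) + 1) * (1 - deriv f t ^ 2)) →
      ∫ t in (0 : ℝ)..a, f t ^ (k + 2) ≤ ∫ θ in (0 : ℝ)..Real.pi, Real.sin θ ^ (k + 2) := by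
  obtain ⟨C, hC, hCk⟩ := exists_constant_for_excess k
  have hε : 0 < 4 / (C + 1) ^ 2 := by positivity
  refine ⟨4 / (C + 1) ^ 2, hε, ?_, ?_⟩
  · rw [div_lt_one (by positivity)]
    nlinarith
  · intro a f hf hrad hsc
    obtain ⟨T, hT, ⟨p, q, h1⟩, ⟨p', q', h2⟩⟩ := exists_risingProfile hε hf hrad hsc
    have hint : ∀ u v, u ∈ Icc 0 a → v ∈ Icc 0 a →
        IntervalIntegrable (fun t => f t ^ (k + 2)) volume u v := fun u v hu hv =>
      ((hf.smooth.continuousOn.pow _).mono (uIcc_subset_Icc hu hv)).intervalIntegrable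
    have e0 : (0 : ℝ) ∈ Icc 0 a := ⟨le_rfl, hf.pos_length.le⟩
    have e1 : a ∈ Icc 0 a := ⟨hf.pos_length.le, le_rfl⟩
    rw [← intervalIntegral.integral_add_adjacent_intervals (hint 0 T e0 (Ioo_subset_Icc_self hT))
      (hint T a (Ioo_subset_Icc_self hT) e1), integral_sin_pow_half]
    have h3 := h1.integral_le hC rfl hCk
    have h4 := h2.integral_le hC rfl hCk
    have h5 := intervalIntegral.integral_comp_sub_left (fun t => f t ^ (k + 2))
      (a := 0) (b := a - T) a
    simp only [sub_sub_cancel, sub_zero] at h5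
    rw [h5] at h4
    linarith


/-! ### Stereographic parametrization of the sphere -/

section Stereographic

/-- The conformal factor `4 / (|y|² + 4)` of inverse stereographic projection. -/
noncomputable def conf {F : Type*} [NormedAddCommGroup F] (y : F) : ℝ := 4 / (‖y‖ ^ 2 + 4)

lemma conf_pos {F : Type*} [NormedAddCommGroup F] (y : F) : 0 < conf y := by
  unfold conf; positivity

lemma conf_zero {F : Type*} [NormedAddCommGroup F] : conf (0 : F) = 1 := by simp [conf]

variable {F V : Type*} [NormedAddCommGroup F] [InnerProductSpace ℝ F]
  [NormedAddCommGroup V] [InnerProductSpace ℝ V]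

lemma hasFDerivAt_conf (y : F) :
    HasFDerivAt (conf : F → ℝ) (-(conf y ^ 2 / 2) • innerSL ℝ y) y := by
  have h1 : HasFDerivAt (fun y : F => ‖y‖ ^ 2 + 4) (2 • innerSL ℝ y) y :=
    (hasStrictFDerivAt_norm_sq y).hasFDerivAt.add_const 4
  have hne : ‖y‖ ^ 2 + 4 ≠ 0 := by positivity
  have h2 := ((hasDerivAt_inv hne).const_mul 4).comp_hasFDerivAt y h1
  refine h2.congr_fderiv ?_
  ext w
  simp [conf]
  field_simp
  norm_num

lemma continuous_conf : Continuous (conf : F → ℝ) :=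
  continuous_iff_continuousAt.2 fun y => (hasFDerivAt_conf y).continuousAt

/-- Inverse stereographic projection from the unit vector `v`, with the hyperplane orthogonal to
`v` identified with `F` by the isometry `U`. -/
noncomputable def stereo (U : F →ₗᵢ[ℝ] V) (v : V) (y : F) : V :=
  v + conf y • (U y - (2 : ℝ) • v)

/-- The differential of `stereo U v` at `y`. -/
noncomputable def stereoDeriv (U : F →ₗᵢ[ℝ] V) (v : V) (y : F) : F →L[ℝ] V :=
  conf y • U.toContinuousLinearMap +
    (-(conf y ^ 2 / 2) • innerSL ℝ y).smulRight (U y - (2 : ℝ) • v)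

lemma stereoDeriv_apply (U : F →ₗᵢ[ℝ] V) (v : V) (y w : F) :
    stereoDeriv U v y w =
      conf y • U w + (-(conf y ^ 2 / 2) * inner ℝ y w) • (U y - (2 : ℝ) • v) := by
  simp [stereoDeriv]

lemma hasFDerivAt_stereo (U : F →ₗᵢ[ℝ] V) (v : V) (y : F) :
    HasFDerivAt (stereo U v) (stereoDeriv U v y) y :=
  ((hasFDerivAt_conf y).smul
    (U.toContinuousLinearMap.hasFDerivAt.sub_const ((2 : ℝ) • v))).const_add v

section Orthogonal

variable {U : F →ₗᵢ[ℝ] V} {v : V} (hv : ‖v‖ = 1) (hU : ∀ y, inner ℝ (U y) v = 0)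
include hv hU

/-- Inverse stereographic projection is conformal, with factor `conf`. -/
lemma inner_stereoDeriv (y w w' : F) :
    inner ℝ (stereoDeriv U v y w) (stereoDeriv U v y w') = conf y ^ 2 * inner ℝ w w' := by
  have hU' : ∀ y, inner ℝ v (U y) = 0 := fun y => by rw [real_inner_comm]; exact hU y
  have hc : conf y * (‖y‖ ^ 2 + 4) = 4 := by unfold conf; field_simp
  simp only [stereoDeriv_apply, inner_add_left, inner_add_right, inner_smul_left, inner_smul_right,
    inner_sub_left, inner_sub_right, LinearIsometry.inner_map_map, hU, hU',
    real_inner_self_eq_norm_sq, hv, real_inner_comm y, conj_trivial]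
  linear_combination (conf y ^ 3 * inner ℝ y w * inner ℝ y w' / 4) * hc

lemma inner_stereo_self (y : F) : inner ℝ (stereo U v y) (stereo U v y) = 1 := by
  have hU' : ∀ y, inner ℝ v (U y) = 0 := fun y => by rw [real_inner_comm]; exact hU y
  have hc : conf y * (‖y‖ ^ 2 + 4) = 4 := by unfold conf; field_simp
  simp only [stereo, inner_add_left, inner_add_right, inner_smul_left, inner_smul_right,
    inner_sub_left, inner_sub_right, LinearIsometry.inner_map_map, hU, hU',
    real_inner_self_eq_norm_sq, hv, conj_trivial]
  linear_combination conf y * hc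

lemma inner_stereo_stereoDeriv (y w : F) :
    inner ℝ (stereo U v y) (stereoDeriv U v y w) = 0 := by
  have hU' : ∀ y, inner ℝ v (U y) = 0 := fun y => by rw [real_inner_comm]; exact hU y
  have hc : conf y * (‖y‖ ^ 2 + 4) = 4 := by unfold conf; field_simp
  simp only [stereo, stereoDeriv_apply, inner_add_left, inner_add_right, inner_smul_left,
    inner_smul_right, inner_sub_left, inner_sub_right, LinearIsometry.inner_map_map, hU, hU',
    real_inner_self_eq_norm_sq, hv, conj_trivial]
  linear_combination (-(conf y ^ 2 * inner ℝ y w) / 2) * hc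

end Orthogonal

end Stereographic

/-! ### The round and the warped metric in stereographic coordinates -/

section Charts

variable {d : ℕ}

/-- The inverse of the chart around `x`, as a map into the ambient Euclidean space. -/
noncomputable def sphParam (x : Sph d) (y : EuclideanSpace ℝ (Fin d)) :
    EuclideanSpace ℝ (Fin (d + 1)) :=
  ((extChartAt (𝓡 d) x).symm y : Sph d)

lemma extChartAt_sph_target (x : Sph d) : (extChartAt (𝓡 d) x).target = univ := by
  have := Fact.mk (@finrank_euclideanSpace_fin ℝ _ (d + 1))
  rw [extChartAt_target]
  change (stereographic' d (-x)).target ∩ _ = univ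
  simp

lemma extChartAt_sph_self (x : Sph d) : extChartAt (𝓡 d) x x = 0 := by
  have := Fact.mk (@finrank_euclideanSpace_fin ℝ _ (d + 1))
  change (OrthonormalBasis.fromOrthogonalSpanSingleton (𝕜 := ℝ) d
    (ne_zero_of_mem_unit_sphere (-x))).repr
      (stereographic (norm_eq_of_mem_sphere (-x)) x) = 0
  rw [stereographic_neg_apply, map_zero]

lemma exists_sphParam_eq_stereo (x : Sph d) :
    ∃ (U : EuclideanSpace ℝ (Fin d) →ₗᵢ[ℝ] EuclideanSpace ℝ (Fin (d + 1)))
      (v : EuclideanSpace ℝ (Fin (d + 1))), ‖v‖ = 1 ∧ (∀ y, inner ℝ (U y) v = 0) ∧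
      sphParam x = stereo U v := by
  have := Fact.mk (@finrank_euclideanSpace_fin ℝ _ (d + 1))
  set W := (OrthonormalBasis.fromOrthogonalSpanSingleton (𝕜 := ℝ) d
    (ne_zero_of_mem_unit_sphere (-x))).repr with hW
  refine ⟨(Submodule.subtypeₗᵢ _).comp W.symm.toLinearIsometry, ((-x : Sph d) : _),
    norm_eq_of_mem_sphere _, fun y => ?_, ?_⟩
  · exact Submodule.mem_orthogonal_singleton_iff_inner_left.1 (W.symm y).2
  · ext1 y
    have h1 : sphParam x y = ((stereographic' d (-x)).symm y : Sph d) := rfl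
    rw [h1, stereographic'_symm_apply]
    have hn : ‖((W.symm y : _) : EuclideanSpace ℝ (Fin (d + 1)))‖ = ‖y‖ := by
      rw [Submodule.norm_coe, LinearIsometryEquiv.norm_map]
    simp only [← hW, hn, stereo, conf]
    have hne : ‖y‖ ^ 2 + 4 ≠ 0 := by positivity
    simp only [LinearIsometry.coe_comp, Function.comp_apply, Submodule.coe_subtypeₗᵢ,
      LinearIsometryEquiv.coe_toLinearIsometry, Submodule.coe_subtype]
    match_scalars
    · field_simp
    · field_simp
      ring

lemma inner_fderiv_sphParam (x : Sph d) (y w w' : EuclideanSpace ℝ (Fin d)) :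
    inner ℝ (fderiv ℝ (sphParam x) y w) (fderiv ℝ (sphParam x) y w')
      = conf y ^ 2 * inner ℝ w w' := by
  obtain ⟨U, v, hv, hU, h⟩ := exists_sphParam_eq_stereo x
  rw [h, (hasFDerivAt_stereo U v y).fderiv, inner_stereoDeriv hv hU]

lemma differentiable_sphParam (x : Sph d) : Differentiable ℝ (sphParam x) := by
  obtain ⟨U, v, hv, hU, h⟩ := exists_sphParam_eq_stereo x
  rw [h]
  exact fun y => (hasFDerivAt_stereo U v y).differentiableAt

lemma mdifferentiableAt_extChartAt_symm {E H M : Type*} [NormedAddCommGroup E] [NormedSpace ℝ E]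
    [TopologicalSpace H] {I : ModelWithCorners ℝ E H} [TopologicalSpace M] [ChartedSpace H M]
    [IsManifold I 1 M] {x : M} {y : E} (h : (extChartAt I x).target = univ) :
    MDifferentiableAt 𝓘(ℝ, E) I (extChartAt I x).symm y :=
  ((contMDiffOn_extChartAt_symm (n := 1) x).contMDiffAt
    (by rw [h]; exact Filter.univ_mem)).mdifferentiableAt one_ne_zero

lemma mdifferentiable_coe_sph :
    MDifferentiable (𝓡 d) 𝓘(ℝ, EuclideanSpace ℝ (Fin (d + 1)))
      (Subtype.val : Sph d → EuclideanSpace ℝ (Fin (d + 1))) := by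
  have := Fact.mk (@finrank_euclideanSpace_fin ℝ _ (d + 1))
  exact (contMDiff_coe_sphere (n := d) (m := 1)).mdifferentiable one_ne_zero

lemma inclDeriv_mfderiv_symm (x : Sph d) (y w : EuclideanSpace ℝ (Fin d)) :
    inclDeriv d ((extChartAt (𝓡 d) x).symm y)
      (mfderiv 𝓘(ℝ, EuclideanSpace ℝ (Fin d)) (𝓡 d) (extChartAt (𝓡 d) x).symm y w)
      = fderiv ℝ (sphParam x) y w := by
  have h := mfderiv_comp y (mdifferentiable_coe_sph (d := d) ((extChartAt (𝓡 d) x).symm y))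
    (mdifferentiableAt_extChartAt_symm (extChartAt_sph_target x) (y := y))
  rw [mfderiv_eq_fderiv] at h
  exact (congrArg (fun L => L w) h).symm

lemma metricInChart_round (x : Sph d) (y : EuclideanSpace ℝ (Fin d)) :
    metricInChart (𝓡 d) (EuclideanSpace.basisFun (Fin d) ℝ).toBasis (roundMetric d) x y
      = Matrix.diagonal fun _ => conf y ^ 2 := by
  ext i j
  simp only [metricInChart, Matrix.of_apply, roundMetric, inclDeriv_mfderiv_symm,
    inner_fderiv_sphParam, Matrix.diagonal_apply]
  have := orthonormal_iff_ite.1 (EuclideanSpace.basisFun (Fin d) ℝ).orthonormal i j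
  simp only [OrthonormalBasis.coe_toBasis, this]
  split_ifs <;> simp

lemma extChartAt_cyl_target (x : ℝ × Sph d) : (extChartAt (cylModel d) x).target = univ := by
  rw [extChartAt_prod, PartialEquiv.prod_target, extChartAt_sph_target,
    extChartAt_model_space_eq_id]
  simp

lemma extChartAt_cyl_self (x : ℝ × Sph d) : extChartAt (cylModel d) x x = (x.1, 0) := by
  rw [extChartAt_prod, extChartAt_model_space_eq_id]
  exact Prod.ext rfl (extChartAt_sph_self x.2)

lemma extChartAt_cyl_symm (x : ℝ × Sph d) (z : ℝ × EuclideanSpace ℝ (Fin d)) :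
    (extChartAt (cylModel d) x).symm z = (z.1, (extChartAt (𝓡 d) x.2).symm z.2) := by
  rw [extChartAt_prod]
  rfl

lemma dtPart_mfderiv_symm (x : ℝ × Sph d) (z w : ℝ × EuclideanSpace ℝ (Fin d)) :
    dtPart d ((extChartAt (cylModel d) x).symm z)
      (mfderiv 𝓘(ℝ, ℝ × EuclideanSpace ℝ (Fin d)) (cylModel d)
        (extChartAt (cylModel d) x).symm z w) = w.1 := by
  have h := mfderiv_comp z
    (mdifferentiableAt_fst (I := 𝓘(ℝ, ℝ)) (I' := 𝓡 d) (M := ℝ) (M' := Sph d)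
      (x := (extChartAt (cylModel d) x).symm z))
    (mdifferentiableAt_extChartAt_symm (extChartAt_cyl_target x) (y := z))
  have h2 : (Prod.fst : ℝ × Sph d → ℝ) ∘ (extChartAt (cylModel d) x).symm = Prod.fst := by
    funext z; rw [Function.comp_apply, extChartAt_cyl_symm]
  rw [h2, mfderiv_eq_fderiv, fderiv_fst] at h
  exact (congrArg (fun L => L w) h).symm

lemma inclDeriv_sphPart_mfderiv_symm (x : ℝ × Sph d) (z w : ℝ × EuclideanSpace ℝ (Fin d)) :
    inclDeriv d ((extChartAt (cylModel d) x).symm z).2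
      (sphPart d ((extChartAt (cylModel d) x).symm z)
        (mfderiv 𝓘(ℝ, ℝ × EuclideanSpace ℝ (Fin d)) (cylModel d)
          (extChartAt (cylModel d) x).symm z w)) = fderiv ℝ (sphParam x.2) z.2 w.2 := by
  have hs := mdifferentiableAt_extChartAt_symm (extChartAt_cyl_target x) (y := z)
  have hsnd := mdifferentiableAt_snd (I := 𝓘(ℝ, ℝ)) (I' := 𝓡 d) (M := ℝ) (M' := Sph d)
      (x := (extChartAt (cylModel d) x).symm z)
  have h := mfderiv_comp z (mdifferentiable_coe_sph (d := d) _) (hsnd.comp z hs)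
  rw [mfderiv_comp z hsnd hs] at h
  have h2 : (Subtype.val : Sph d → EuclideanSpace ℝ (Fin (d + 1))) ∘
      ((Prod.snd : ℝ × Sph d → Sph d) ∘ (extChartAt (cylModel d) x).symm)
        = sphParam x.2 ∘ Prod.snd := by
    funext z; simp only [Function.comp_apply]; rw [extChartAt_cyl_symm]; rfl
  rw [h2, mfderiv_eq_fderiv, fderiv_comp z (differentiable_sphParam _ _) differentiableAt_snd,
    fderiv_snd] at h
  exact (congrArg (fun L => L w) h).symm

/-- The diagonal entries of the warped metric in stereographic coordinates. -/
noncomputable def warpedEntry (d : ℕ) (f : ℝ → ℝ) (i : Unit ⊕ Fin d)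
    (z : ℝ × EuclideanSpace ℝ (Fin d)) : ℝ :=
  Sum.elim (fun _ => 1) (fun _ => (f z.1 * conf z.2) ^ 2) i

lemma metricInChart_warped (f : ℝ → ℝ) (x : ℝ × Sph d) (z : ℝ × EuclideanSpace ℝ (Fin d)) :
    metricInChart (cylModel d) (cylBasis d) (warpedMetric d f) x z
      = Matrix.diagonal fun i => warpedEntry d f i z := by
  ext i j
  simp only [metricInChart, Matrix.of_apply, warpedMetric, roundMetric, dtPart_mfderiv_symm,
    inclDeriv_sphPart_mfderiv_symm, inner_fderiv_sphParam, Matrix.diagonal_apply]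
  rw [extChartAt_cyl_symm]
  have h := orthonormal_iff_ite.1 (EuclideanSpace.basisFun (Fin d) ℝ).orthonormal
  rcases i with i | i <;> rcases j with j | j
  · simp [cylBasis, warpedEntry]
  · simp [cylBasis]
  · simp [cylBasis]
  · simp only [cylBasis, Module.Basis.prod_apply_inr_fst, Module.Basis.prod_apply_inr_snd,
      OrthonormalBasis.coe_toBasis, h, warpedEntry, Sum.elim_inr, Sum.inr.injEq]
    split_ifs <;> ring

end Charts


/-! ### Curvature of the warped metric in coordinates -/

section Curvature

lemma inv_diagonal_of_ne_zero {ι : Type*} [Fintype ι] [DecidableEq ι] {v : ι → ℝ}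
    (hv : ∀ i, v i ≠ 0) : (Matrix.diagonal v)⁻¹ = Matrix.diagonal fun i => (v i)⁻¹ := by
  refine Matrix.inv_eq_right_inv ?_
  rw [Matrix.diagonal_mul_diagonal, ← Matrix.diagonal_one]
  congr 1
  ext i
  exact mul_inv_cancel₀ (hv i)

lemma pderiv_eq_of_hasFDerivAt {E ι : Type*} [NormedAddCommGroup E] [NormedSpace ℝ E]
    {b : Module.Basis ι ℝ E} {h : E → ℝ} {L : E →L[ℝ] ℝ} {y : E} (hL : HasFDerivAt h L y) (i : ι) :
    pderiv b i h y = L (b i) := by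
  rw [pderiv, hL.fderiv]

lemma pderiv_const {E ι : Type*} [NormedAddCommGroup E] [NormedSpace ℝ E]
    {b : Module.Basis ι ℝ E} (c : ℝ) (i : ι) (y : E) : pderiv b i (fun _ => c) y = 0 := by
  simp [pderiv]

lemma christoffel_diagonal {E ι : Type*} [NormedAddCommGroup E] [NormedSpace ℝ E]
    [Fintype ι] [DecidableEq ι] (b : Module.Basis ι ℝ E) (e : ι → E → ℝ) (k i j : ι) {y : E}
    (he : ∀ i, e i y ≠ 0) :
    christoffel b (fun z => Matrix.diagonal fun i => e i z) k i j y
      = 1 / 2 * ((e k y)⁻¹ * ((if j = k then pderiv b i (e j) y else 0)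
        + (if i = k then pderiv b j (e i) y else 0)
        - (if i = j then pderiv b k (e i) y else 0))) := by
  have hp : ∀ m i j, pderiv b m (fun z => (Matrix.diagonal fun i => e i z) i j) y
      = if i = j then pderiv b m (e i) y else 0 := by
    intro m i j
    by_cases h : i = j
    · subst h; simp
    · simp [h, pderiv_const]
  simp only [christoffel, hp, inv_diagonal_of_ne_zero he]
  rw [Finset.sum_eq_single k]
  · simp
  · intro l _ hl
    simp [Matrix.diagonal_apply_ne _ hl.symm]
  · simp

variable {d : ℕ}

@[simp] lemma cylBasis_inl (u : Unit) : cylBasis d (Sum.inl u) = (1, 0) := by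
  simp [cylBasis]

@[simp] lemma cylBasis_inr (i : Fin d) :
    cylBasis d (Sum.inr i) = (0, EuclideanSpace.single i 1) := by
  simp [cylBasis]

lemma hasFDerivAt_comp_fst {h : ℝ → ℝ} {h' : ℝ} {z : ℝ × EuclideanSpace ℝ (Fin d)}
    (hh : HasDerivAt h h' z.1) :
    HasFDerivAt (fun z : ℝ × EuclideanSpace ℝ (Fin d) => h z.1)
      (h' • ContinuousLinearMap.fst ℝ ℝ (EuclideanSpace ℝ (Fin d))) z :=
  hh.comp_hasFDerivAt z hasFDerivAt_fst

lemma hasFDerivAt_conf_snd (z : ℝ × EuclideanSpace ℝ (Fin d)) :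
    HasFDerivAt (fun z : ℝ × EuclideanSpace ℝ (Fin d) => conf z.2)
      ((-(conf z.2 ^ 2 / 2) • innerSL ℝ z.2).comp
        (ContinuousLinearMap.snd ℝ ℝ (EuclideanSpace ℝ (Fin d)))) z :=
  (hasFDerivAt_conf z.2).comp z hasFDerivAt_snd

lemma pderiv_warpedEntry_inr {f : ℝ → ℝ} {z : ℝ × EuclideanSpace ℝ (Fin d)}
    (hf : DifferentiableAt ℝ f z.1) (i : Unit ⊕ Fin d) (j : Fin d) :
    pderiv (cylBasis d) i (warpedEntry d f (Sum.inr j)) z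
      = Sum.elim (fun _ => 2 * f z.1 * deriv f z.1 * conf z.2 ^ 2)
          (fun m => -(f z.1 ^ 2 * conf z.2 ^ 3 * z.2 m)) i := by
  have h := ((hasFDerivAt_comp_fst hf.hasDerivAt).mul (hasFDerivAt_conf_snd z)).pow 2
  have h2 := pderiv_eq_of_hasFDerivAt (b := cylBasis d) h i
  refine h2.trans ?_
  rcases i with i | i
  · simp
    ring
  · simp [EuclideanSpace.inner_single_right]
    ring

/-- The Christoffel symbols of the warped metric in stereographic coordinates. -/
noncomputable def warpedChristoffel (d : ℕ) (f : ℝ → ℝ) :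
    (k i j : Unit ⊕ Fin d) → ℝ × EuclideanSpace ℝ (Fin d) → ℝ
  | .inl _, .inr i, .inr j => fun z =>
      if i = j then -(f z.1 * deriv f z.1 * conf z.2 ^ 2) else 0
  | .inr k, .inl _, .inr j => fun z => if j = k then deriv f z.1 / f z.1 else 0
  | .inr k, .inr i, .inl _ => fun z => if i = k then deriv f z.1 / f z.1 else 0
  | .inr k, .inr i, .inr j => fun z => -(conf z.2 / 2) *
      ((if j = k then z.2 i else 0) + (if i = k then z.2 j else 0) - (if i = j then z.2 k else 0))
  | _, _, _ => fun _ => 0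

lemma christoffel_warped {f : ℝ → ℝ} {z : ℝ × EuclideanSpace ℝ (Fin d)} (hf0 : f z.1 ≠ 0)
    (hf : DifferentiableAt ℝ f z.1) (k i j : Unit ⊕ Fin d) :
    christoffel (cylBasis d) (fun z => Matrix.diagonal fun i => warpedEntry d f i z) k i j z
      = warpedChristoffel d f k i j z := by
  have hc := (conf_pos z.2).ne'
  have h0 : ∀ m (u : Unit), pderiv (cylBasis d) m (warpedEntry d f (Sum.inl u)) z = 0 :=
    fun m u => pderiv_const 1 m z
  rw [christoffel_diagonal]
  · rcases k with k | k <;> rcases i with i | i <;> rcases j with j | j <;>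
      simp only [h0, pderiv_warpedEntry_inr hf, warpedChristoffel, Sum.elim_inl, Sum.elim_inr,
        reduceCtorEq, if_false, Sum.inr.injEq, warpedEntry, ite_self]
    · simp
    · simp
    · simp
    · split_ifs <;> simp; ring
    · simp
    · split_ifs <;> simp; field_simp
    · split_ifs <;> simp; field_simp
    · split_ifs <;> simp <;> field_simp <;> ring
  · rintro (i | i)
    · simp [warpedEntry]
    · simp [warpedEntry, hf0, hc]

/-- At the centre `y = 0` of the chart, where `conf` is `1` and `ℓ` vanishes, only `ℓ` gets
differentiated. -/
lemma pderiv_conf_mul_linear (ℓ : EuclideanSpace ℝ (Fin d) →L[ℝ] ℝ) (t : ℝ) (m : Fin d) :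
    pderiv (cylBasis d) (Sum.inr m) (fun z => -(conf z.2 / 2) * ℓ z.2) (t, 0)
      = -(1 / 2) * ℓ (EuclideanSpace.single m 1) := by
  have h1 : HasFDerivAt (fun z : ℝ × EuclideanSpace ℝ (Fin d) => ℓ z.2)
      (ℓ.comp (ContinuousLinearMap.snd ℝ ℝ (EuclideanSpace ℝ (Fin d)))) (t, 0) :=
    ℓ.hasFDerivAt.comp (t, 0) hasFDerivAt_snd
  have h2 := ((hasFDerivAt_conf_snd (d := d) (t, 0)).mul_const (1 / 2)).neg.mul h1
  have h3 := pderiv_eq_of_hasFDerivAt (b := cylBasis d) h2 (Sum.inr m)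
  have h4 : (fun z : ℝ × EuclideanSpace ℝ (Fin d) => -(conf z.2 / 2) * ℓ z.2)
      = fun z => -(conf z.2 * (1 / 2)) * ℓ z.2 := by ext z; ring
  rw [h4]
  refine h3.trans ?_
  simp [conf_zero]

lemma pderiv_warpedChristoffel_inr (f : ℝ → ℝ) (t : ℝ) (m k i j : Fin d) :
    pderiv (cylBasis d) (Sum.inr m) (warpedChristoffel d f (.inr k) (.inr i) (.inr j)) (t, 0)
      = -(1 / 2) * ((if j = k then (if i = m then 1 else 0) else 0)
        + (if i = k then (if j = m then 1 else 0) else 0)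
        - (if i = j then (if k = m then 1 else 0) else 0)) := by
  have h := pderiv_conf_mul_linear ((if j = k then EuclideanSpace.proj i else 0)
    + (if i = k then EuclideanSpace.proj j else 0)
    - (if i = j then EuclideanSpace.proj k else 0) : EuclideanSpace ℝ (Fin d) →L[ℝ] ℝ) t m
  convert! h using 1
  · congr 1
    ext z
    simp only [warpedChristoffel, _root_.sub_apply, _root_.add_apply]
    split_ifs <;> simp
  · simp only [_root_.sub_apply, _root_.add_apply]
    split_ifs <;> simp_all

lemma pderiv_inl_div {f : ℝ → ℝ} {t q : ℝ} (hf0 : f t ≠ 0) (hf : DifferentiableAt ℝ f t)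
    (hq : HasDerivAt (deriv f) q t) (u : Unit) :
    pderiv (cylBasis d) (Sum.inl u) (fun z => deriv f z.1 / f z.1) (t, 0)
      = (q * f t - deriv f t ^ 2) / f t ^ 2 := by
  have h := pderiv_eq_of_hasFDerivAt (b := cylBasis d)
    (hasFDerivAt_comp_fst (d := d) (z := (t, 0)) (hq.div hf.hasDerivAt hf0)) (Sum.inl u)
  refine h.trans ?_
  simp [sq]

lemma pderiv_inl_mul {f : ℝ → ℝ} {t q : ℝ} (hf : DifferentiableAt ℝ f t)
    (hq : HasDerivAt (deriv f) q t) (u : Unit) :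
    pderiv (cylBasis d) (Sum.inl u) (fun z => -(f z.1 * deriv f z.1 * conf z.2 ^ 2)) (t, 0)
      = -(deriv f t ^ 2 + f t * q) := by
  have h := pderiv_eq_of_hasFDerivAt (b := cylBasis d)
    ((hasFDerivAt_comp_fst (d := d) (z := (t, 0)) (hf.hasDerivAt.mul hq)).mul
      ((hasFDerivAt_conf_snd (d := d) (t, 0)).pow 2)).neg (Sum.inl u)
  refine h.trans ?_
  simp [conf_zero]
  ring

variable {f : ℝ → ℝ} {t q : ℝ}

/-- The derivatives of the Christoffel symbols may be taken from their explicit form, which holds on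
a neighbourhood of the point. -/
lemma pderiv_christoffel_warped (hf : ∀ᶠ s in nhds t, f s ≠ 0 ∧ DifferentiableAt ℝ f s)
    (m k i j : Unit ⊕ Fin d) :
    pderiv (cylBasis d) m
      (christoffel (cylBasis d) (fun z => Matrix.diagonal fun i => warpedEntry d f i z) k i j)
        (t, 0)
      = pderiv (cylBasis d) m (warpedChristoffel d f k i j) (t, 0) := by
  have h : christoffel (cylBasis d) (fun z => Matrix.diagonal fun i => warpedEntry d f i z) k i j
      =ᶠ[nhds (t, 0)] warpedChristoffel d f k i j := by
    have h1 : Filter.Tendsto Prod.fst (nhds (t, (0 : EuclideanSpace ℝ (Fin d)))) (nhds t) :=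
      continuous_fst.continuousAt
    filter_upwards [h1.eventually hf] with z hz
    exact christoffel_warped hz.1 hz.2 k i j
  rw [pderiv, pderiv, h.fderiv_eq]

/-- The Ricci curvature of the warped metric in the direction `∂t`. -/
lemma ricciCoord_warped_inl (hf : ∀ᶠ s in nhds t, f s ≠ 0 ∧ DifferentiableAt ℝ f s)
    (hq : HasDerivAt (deriv f) q t) (u : Unit) :
    ricciCoord (cylBasis d) (fun z => Matrix.diagonal fun i => warpedEntry d f i z)
      (.inl u) (.inl u) (t, 0) = -d * (q / f t) := by
  have hf0 := hf.self_of_nhds.1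
  have hfd := hf.self_of_nhds.2
  simp only [ricciCoord, pderiv_christoffel_warped hf]
  simp only [christoffel_warped (z := (t, 0)) hf0 hfd, Fintype.sum_sum_type, warpedChristoffel,
    pderiv_const, pderiv_inl_div hf0 hfd hq, if_true]
  simp
  field_simp
  ring

/-- The Ricci curvature of the warped metric along the sphere. -/
lemma ricciCoord_warped_inr (hf : ∀ᶠ s in nhds t, f s ≠ 0 ∧ DifferentiableAt ℝ f s)
    (hq : HasDerivAt (deriv f) q t) (j : Fin d) :
    ricciCoord (cylBasis d) (fun z => Matrix.diagonal fun i => warpedEntry d f i z)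
      (.inr j) (.inr j) (t, 0) = (d - 1) * (1 - deriv f t ^ 2) - f t * q := by
  have hf0 := hf.self_of_nhds.1
  have hfd := hf.self_of_nhds.2
  simp only [ricciCoord, pderiv_christoffel_warped hf]
  simp only [christoffel_warped (z := (t, 0)) hf0 hfd, Fintype.sum_sum_type,
    pderiv_warpedChristoffel_inr]
  simp only [warpedChristoffel, if_true, pderiv_const, pderiv_inl_mul hfd hq]
  simp [conf_zero, mul_sub, mul_add, Finset.sum_sub_distrib, Finset.sum_add_distrib]
  field_simp
  ring

end Curvature


/-! ### The curvature bounds as differential inequalities for the warping function -/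

section CurvatureBounds

variable {d : ℕ} {f : ℝ → ℝ} {q : ℝ} {x : ℝ × Sph d}

lemma metricInChart_warped_eq (f : ℝ → ℝ) (x : ℝ × Sph d) :
    metricInChart (cylModel d) (cylBasis d) (warpedMetric d f) x
      = fun z => Matrix.diagonal fun i => warpedEntry d f i z :=
  funext fun z => metricInChart_warped f x z

/-- The unit tangent vector `∂t`, with its length and its Ricci curvature. -/
lemma exists_unit_axial_vector (hf : ∀ᶠ s in nhds x.1, f s ≠ 0 ∧ DifferentiableAt ℝ f s)
    (hq : HasDerivAt (deriv f) q x.1) :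
    ∃ v : TangentSpace (cylModel d) x, warpedMetric d f x v v = 1 ∧
      ricci (cylModel d) (cylBasis d) (warpedMetric d f) x v v = -d * (q / f x.1) := by
  set y := extChartAt (cylModel d) x x with hy
  have hsymm : (extChartAt (cylModel d) x).symm y = x := extChartAt_to_inv x
  set v : ℝ × EuclideanSpace ℝ (Fin d) :=
    mfderiv 𝓘(ℝ, ℝ × EuclideanSpace ℝ (Fin d)) (cylModel d)
      (extChartAt (cylModel d) x).symm y (cylBasis d (Sum.inl ())) with hv
  refine ⟨v, ?_, ?_⟩
  · have h1 := congrFun (congrFun (metricInChart_warped f x y) (Sum.inl ())) (Sum.inl ())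
    rw [Matrix.diagonal_apply_eq] at h1
    -- All tangent spaces are the model space, so `v` may be regarded as a vector at both points.
    have h2 : warpedMetric d f ((extChartAt (cylModel d) x).symm y) v v = warpedMetric d f x v v :=
      congrArg (fun p => warpedMetric d f p v v) hsymm
    exact h2.symm.trans h1
  · have hcoord : ∀ j, vectorCoord (cylModel d) (cylBasis d) x v j
        = if Sum.inl () = j then 1 else 0 := by
      intro j
      have h1 := mfderiv_extChartAt_comp_mfderivWithin_extChartAt_symm (I := cylModel d) (x := x)
        (y := y) (by rw [extChartAt_cyl_target]; trivial)
      rw [ModelWithCorners.range_eq_univ, mfderivWithin_univ] at h1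
      have h2 := congrArg (fun L => L (cylBasis d (Sum.inl ()))) h1
      have h3 : (mfderiv (cylModel d) 𝓘(ℝ, ℝ × EuclideanSpace ℝ (Fin d))
          (extChartAt (cylModel d) x) x v : ℝ × EuclideanSpace ℝ (Fin d))
          = cylBasis d (Sum.inl ()) := by
        refine Eq.trans ?_ h2
        exact congrArg (fun p => (mfderiv (cylModel d) 𝓘(ℝ, ℝ × EuclideanSpace ℝ (Fin d))
          (extChartAt (cylModel d) x) p v : ℝ × EuclideanSpace ℝ (Fin d))) hsymm.symm
      have h4 : vectorCoord (cylModel d) (cylBasis d) x v j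
          = (cylBasis d).repr (cylBasis d (Sum.inl ())) j :=
        congrArg (fun w => (cylBasis d).repr w j) h3
      rw [h4, Module.Basis.repr_self, Finsupp.single_apply]
    simp only [ricci, hcoord, metricInChart_warped_eq]
    rw [extChartAt_cyl_self, Finset.sum_eq_single (Sum.inl ()), Finset.sum_eq_single (Sum.inl ()),
      ricciCoord_warped_inl hf hq]
    · simp
    · intro k _ hk
      simp [hk.symm]
    · simp
    · intro j _ hj
      simp [hj.symm]
    · simp

lemma scalarCurvature_warped (hf : ∀ᶠ s in nhds x.1, f s ≠ 0 ∧ DifferentiableAt ℝ f s)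
    (hq : HasDerivAt (deriv f) q x.1) :
    scalarCurvature (cylModel d) (cylBasis d) (warpedMetric d f) x
      = -d * (q / f x.1) + d * (((d - 1) * (1 - deriv f x.1 ^ 2) - f x.1 * q) / f x.1 ^ 2) := by
  have hf0 := hf.self_of_nhds.1
  simp only [scalarCurvature, scalarCoord, metricInChart_warped_eq]
  rw [extChartAt_cyl_self, inv_diagonal_of_ne_zero]
  · have h : ∀ j, ∑ k, Matrix.diagonal (fun i => (warpedEntry d f i (x.1, 0))⁻¹) j k *
        ricciCoord (cylBasis d) (fun z => Matrix.diagonal fun i => warpedEntry d f i z) j k (x.1, 0)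
        = (warpedEntry d f j (x.1, 0))⁻¹ * ricciCoord (cylBasis d)
          (fun z => Matrix.diagonal fun i => warpedEntry d f i z) j j (x.1, 0) := by
      intro j
      rw [Finset.sum_eq_single j]
      · simp
      · intro k _ hk
        simp [Matrix.diagonal_apply_ne _ hk.symm]
      · simp
    simp only [h, Fintype.sum_sum_type, ricciCoord_warped_inl hf hq, ricciCoord_warped_inr hf hq]
    simp [warpedEntry, conf_zero, div_eq_inv_mul]
  · rintro (i | i)
    · simp [warpedEntry]
    · simp [warpedEntry, hf0, conf_zero]

instance nonempty_sph (d : ℕ) : Nonempty (Sph d) :=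
  (NormedSpace.sphere_nonempty.2 zero_le_one).to_subtype

lemma IsWarpingFunction.eventually_regular {a t : ℝ} (hf : IsWarpingFunction a f)
    (ht : t ∈ Ioo 0 a) : ∀ᶠ s in nhds t, f s ≠ 0 ∧ DifferentiableAt ℝ f s := by
  filter_upwards [Ioo_mem_nhds ht.1 ht.2] with s hs
  exact ⟨(hf.pos s hs).ne', (hf.smooth.differentiableOn (by simp)).differentiableAt
      (Icc_mem_nhds hs.1 hs.2)⟩

lemma IsWarpingFunction.hasDerivAt_deriv {a t : ℝ} (hf : IsWarpingFunction a f)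
    (ht : t ∈ Ioo 0 a) : HasDerivAt (deriv f) (deriv (deriv f) t) t := by
  have h1 : ContDiffOn ℝ 2 f (Ioo 0 a) :=
    (hf.smooth.of_le (WithTop.coe_le_coe.2 le_top)).mono Ioo_subset_Icc_self
  have h2 : ContDiffOn ℝ 1 (deriv f) (Ioo 0 a) := h1.deriv_of_isOpen isOpen_Ioo (by norm_num)
  exact ((h2.differentiableOn one_ne_zero).differentiableAt (Ioo_mem_nhds ht.1 ht.2)).hasDerivAt

lemma radial_of_ricci_bound {a ε : ℝ} (hd : d ≠ 0) (hf : IsWarpingFunction a f)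
    (h : ∀ x ∈ regularPart d a, ∀ v : TangentSpace (cylModel d) x,
      ε * d * warpedMetric d f x v v ≤ ricci (cylModel d) (cylBasis d) (warpedMetric d f) x v v)
    {t : ℝ} (ht : t ∈ Ioo 0 a) : ε * f t ≤ -deriv (deriv f) t := by
  obtain ⟨p⟩ := nonempty_sph d
  obtain ⟨v, hv1, hv2⟩ := exists_unit_axial_vector (x := (t, p)) (hf.eventually_regular ht)
    (hf.hasDerivAt_deriv ht)
  have h1 := h (t, p) ⟨ht, trivial⟩ v
  rw [hv1, hv2] at h1
  have hft := hf.pos t ht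
  have hd' : (0 : ℝ) < d := by exact_mod_cast Nat.pos_of_ne_zero hd
  have h2 : ε ≤ -(deriv (deriv f) t / f t) := by
    refine le_of_mul_le_mul_left ?_ hd'
    simp only at h1
    linarith
  calc ε * f t ≤ -(deriv (deriv f) t / f t) * f t := by gcongr
    _ = _ := by field_simp

lemma profile_bound_of_scalar_bound {a : ℝ} (hd : d ≠ 0) (hf : IsWarpingFunction a f)
    (h : ∀ x ∈ regularPart d a, ((d : ℝ) + 1) * d ≤
      scalarCurvature (cylModel d) (cylBasis d) (warpedMetric d f) x)
    {t : ℝ} (ht : t ∈ Ioo 0 a) : ((d : ℝ) + 1) * f t ^ 2 ≤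
      -2 * f t * deriv (deriv f) t + ((d : ℝ) - 1) * (1 - deriv f t ^ 2) := by
  obtain ⟨p⟩ := nonempty_sph d
  have h1 := h (t, p) ⟨ht, trivial⟩
  rw [scalarCurvature_warped (x := (t, p)) (hf.eventually_regular ht)
    (hf.hasDerivAt_deriv ht)] at h1
  simp only at h1
  have hft := hf.pos t ht
  have hd' : (0 : ℝ) < d := by exact_mod_cast Nat.pos_of_ne_zero hd
  refine le_of_mul_le_mul_left ?_ hd'
  have h2 := mul_le_mul_of_nonneg_right h1 (sq_nonneg (f t))
  field_simp at h2
  nlinarith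

end CurvatureBounds


/-! ### The volume of the round sphere -/

section SphereVolume

lemma image_two_mul_arctan :
    (fun y : ℝ => 2 * Real.arctan (y / 2)) '' Ioi 0 = Ioo 0 Real.pi := by
  ext α
  constructor
  · rintro ⟨y, hy, rfl⟩
    have hy' : 0 < y / 2 := half_pos hy
    have h1 := Real.arctan_pos.2 hy'
    have h2 := Real.arctan_lt_pi_div_two (y / 2)
    exact ⟨by simp only; linarith, by simp only; linarith⟩
  · rintro ⟨h0, h1⟩
    refine ⟨2 * Real.tan (α / 2), ?_, ?_⟩
    · have := Real.tan_pos_of_pos_of_lt_pi_div_two (x := α / 2) (by linarith) (by linarith)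
      exact mul_pos two_pos this
    · simp only
      rw [mul_div_cancel_left₀ _ two_ne_zero, Real.arctan_tan (by linarith) (by linarith)]
      ring

lemma hasDerivAt_two_mul_arctan (y : ℝ) :
    HasDerivAt (fun y : ℝ => 2 * Real.arctan (y / 2)) (4 / (y ^ 2 + 4)) y := by
  refine ((((hasDerivAt_id y).div_const 2).arctan).const_mul 2).congr_deriv ?_
  simp only [id]
  field_simp
  ring

lemma injective_two_mul_arctan : Function.Injective fun y : ℝ => 2 * Real.arctan (y / 2) := by
  intro x y h
  have := Real.arctan_injective (mul_left_cancel₀ two_ne_zero h)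
  linarith

lemma sin_two_mul_arctan (y : ℝ) :
    Real.sin (2 * Real.arctan (y / 2)) = 4 / (y ^ 2 + 4) * y := by
  have h : 0 < 1 + (y / 2) ^ 2 := by positivity
  rw [Real.sin_two_mul, Real.sin_arctan, Real.cos_arctan]
  have hs := Real.mul_self_sqrt h.le
  have hne : √(1 + (y / 2) ^ 2) ≠ 0 := (Real.sqrt_pos.2 h).ne'
  have : 2 * (y / 2 / √(1 + (y / 2) ^ 2)) * (1 / √(1 + (y / 2) ^ 2))
      = y / (√(1 + (y / 2) ^ 2) * √(1 + (y / 2) ^ 2)) := by field_simp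
  rw [this, hs]
  field_simp
  ring

/-- The substitution `θ = 2 arctan (y / 2)` turns `sin θ ^ d dθ` into the radial volume element of
the round metric in stereographic coordinates. -/
lemma arctan_substitution (d : ℕ) (y : ℝ) :
    |4 / (y ^ 2 + 4)| • Real.sin (2 * Real.arctan (y / 2)) ^ d
      = y ^ d • (4 / (y ^ 2 + 4)) ^ (d + 1) := by
  rw [abs_of_pos (by positivity), sin_two_mul_arctan, smul_eq_mul, smul_eq_mul]
  ring

lemma lintegral_conf_pow (d : ℕ) :
    ∫⁻ y : EuclideanSpace ℝ (Fin (d + 1)), ENNReal.ofReal (conf y ^ (d + 1))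
      = ENNReal.ofReal (∫ θ in (0 : ℝ)..Real.pi, Real.sin θ ^ d) *
        (volume : Measure (EuclideanSpace ℝ (Fin (d + 1)))).toSphere univ := by
  have hfin : Module.finrank ℝ (EuclideanSpace ℝ (Fin (d + 1))) = d + 1 :=
    finrank_euclideanSpace_fin
  have hint : IntegrableOn (fun y : ℝ => y ^ d • (4 / (y ^ 2 + 4)) ^ (d + 1)) (Ioi 0) := by
    have h := (integrableOn_image_iff_integrableOn_abs_deriv_smul measurableSet_Ioi
      (fun y _ => (hasDerivAt_two_mul_arctan y).hasDerivWithinAt)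
      injective_two_mul_arctan.injOn (fun θ => Real.sin θ ^ d)).1 (by
        rw [image_two_mul_arctan]
        exact (Continuous.integrableOn_Icc (by fun_prop)).mono_set Ioo_subset_Icc_self)
    simpa only [arctan_substitution] using h
  have hval : ∫ y in Ioi (0 : ℝ), y ^ d • (4 / (y ^ 2 + 4)) ^ (d + 1)
      = ∫ θ in (0 : ℝ)..Real.pi, Real.sin θ ^ d := by
    have h := integral_image_eq_integral_abs_deriv_smul (measurableSet_Ioi (a := (0 : ℝ)))
      (fun y _ => (hasDerivAt_two_mul_arctan y).hasDerivWithinAt)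
      injective_two_mul_arctan.injOn (fun θ => Real.sin θ ^ d)
    rw [image_two_mul_arctan] at h
    simp only [arctan_substitution] at h
    rw [← h, intervalIntegral.integral_of_le Real.pi_pos.le, integral_Ioc_eq_integral_Ioo]
  have hI : Integrable (fun y : EuclideanSpace ℝ (Fin (d + 1)) => conf y ^ (d + 1)) := by
    have h := (integrable_fun_norm_addHaar (volume : Measure (EuclideanSpace ℝ (Fin (d + 1))))
      (f := fun r : ℝ => (4 / (r ^ 2 + 4)) ^ (d + 1))).2
    rw [hfin, Nat.add_sub_cancel] at h
    exact h hint
  have hV := integral_fun_norm_addHaar (volume : Measure (EuclideanSpace ℝ (Fin (d + 1))))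
    (fun r : ℝ => (4 / (r ^ 2 + 4)) ^ (d + 1))
  rw [hfin, Nat.add_sub_cancel, hval] at hV
  rw [← ofReal_integral_eq_lintegral_ofReal hI
    (Filter.Eventually.of_forall fun y => pow_nonneg (conf_pos y).le _)]
  have h2 : ∫ y : EuclideanSpace ℝ (Fin (d + 1)), conf y ^ (d + 1)
      = (volume : Measure (EuclideanSpace ℝ (Fin (d + 1)))).toSphere.real univ
        * ∫ θ in (0 : ℝ)..Real.pi, Real.sin θ ^ d := by
    rw [Measure.toSphere_real_apply_univ, hfin]
    refine hV.trans ?_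
    rw [nsmul_eq_mul, smul_eq_mul]
    ring
  rw [h2, ENNReal.ofReal_mul measureReal_nonneg, ofReal_measureReal, mul_comm]

lemma sqrt_pow_sq_prod {m : ℕ} {c : ℝ} (hc : 0 ≤ c) : √((c ^ 2) ^ m) = c ^ m := by
  rw [← pow_mul, mul_comm, pow_mul, Real.sqrt_sq (pow_nonneg hc m)]

variable {d : ℕ}

lemma continuous_extChartAt_sph_symm (x : Sph d) : Continuous (extChartAt (𝓡 d) x).symm := by
  have h := continuousOn_extChartAt_symm (I := 𝓡 d) x
  rw [extChartAt_sph_target] at h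
  exact continuousOn_univ.1 h

lemma chartVolume_round (x : Sph d) :
    chartVolume (𝓡 d) (EuclideanSpace.basisFun (Fin d) ℝ).toBasis (roundMetric d) x
      = (volume.withDensity fun y => ENNReal.ofReal (conf y ^ d)).map
        (extChartAt (𝓡 d) x).symm := by
  rw [chartVolume, extChartAt_sph_target, Measure.restrict_univ,
    OrthonormalBasis.addHaar_eq_volume]
  congr 2
  ext y
  rw [metricInChart_round, Matrix.det_diagonal]
  simp [sqrt_pow_sq_prod (conf_pos y).le]

/-- A single stereographic chart already carries at least this volume. -/
lemma le_sphereVolume (d : ℕ) :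
    ENNReal.ofReal (∫ θ in (0 : ℝ)..Real.pi, Real.sin θ ^ d) *
      (volume : Measure (EuclideanSpace ℝ (Fin (d + 1)))).toSphere univ ≤ sphereVolume (d + 1) := by
  obtain ⟨p⟩ := nonempty_sph (d + 1)
  refine le_trans (le_of_eq ?_) (Measure.le_iff'.1 (le_iSup (chartVolume (𝓡 (d + 1))
    (EuclideanSpace.basisFun (Fin (d + 1)) ℝ).toBasis (roundMetric (d + 1))) p) univ)
  rw [chartVolume_round, Measure.map_apply (continuous_extChartAt_sph_symm p).measurable .univ,
    preimage_univ, withDensity_apply _ .univ, Measure.restrict_univ, lintegral_conf_pow]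

end SphereVolume

/-! ### Charts of the sphere and the cone measure -/

section Cone

open scoped Pointwise

lemma sq_det_eq_det_gram {E ι : Type*} [NormedAddCommGroup E] [InnerProductSpace ℝ E]
    [Fintype ι] [DecidableEq ι] (b : OrthonormalBasis ι ℝ E) (A : E →L[ℝ] E) :
    A.det ^ 2 = (Matrix.of fun i j => inner ℝ (A (b i)) (A (b j)) : Matrix ι ι ℝ).det := by
  set M := LinearMap.toMatrix b.toBasis b.toBasis (A : E →ₗ[ℝ] E) with hM
  have h1 : (Matrix.of fun i j => inner ℝ (A (b i)) (A (b j)) : Matrix ι ι ℝ)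
      = M.transpose * M := by
    ext i j
    rw [Matrix.mul_apply, Matrix.of_apply, ← b.sum_inner_mul_inner]
    refine Finset.sum_congr rfl fun k _ => ?_
    simp [hM, LinearMap.toMatrix_apply, b.repr_apply_apply, real_inner_comm]
  rw [h1, Matrix.det_mul, Matrix.det_transpose, hM, LinearMap.det_toMatrix, sq]

variable {d : ℕ}

/-- The orthogonal sum of the radial line and the coordinate space of a chart. -/
abbrev Polar (d : ℕ) := WithLp 2 (ℝ × EuclideanSpace ℝ (Fin d))

lemma exists_polar_isometry (d : ℕ) :
    Nonempty (Polar d ≃ₗᵢ[ℝ] EuclideanSpace ℝ (Fin (d + 1))) := by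
  have h : Module.finrank ℝ (Polar d) = d + 1 := by
    rw [(WithLp.linearEquiv 2 ℝ (ℝ × EuclideanSpace ℝ (Fin d))).finrank_eq]
    simp [add_comm]
  exact ⟨((stdOrthonormalBasis ℝ (Polar d)).reindex (finCongr h)).repr⟩

/-- The polar coordinates `(r, y) ↦ r • sphParam x y` of the ambient space, where `y` is the
coordinate of the direction in the chart around `x`. The isometry `Q` brings the target back to the source
space, as the change of variables formula requires. -/
noncomputable def coneMap (Q : Polar d ≃ₗᵢ[ℝ] EuclideanSpace ℝ (Fin (d + 1))) (x : Sph d)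
    (w : Polar d) : Polar d := Q.symm (w.fst • sphParam x w.snd)

/-- The Gram matrix of the differential of `coneMap` is diagonal, with entries `1` and
`(r * conf y) ^ 2`, because `sphParam x` is conformal and orthogonal to its derivatives. -/
lemma exists_hasFDerivAt_coneMap (Q : Polar d ≃ₗᵢ[ℝ] EuclideanSpace ℝ (Fin (d + 1))) (x : Sph d)
    (w : Polar d) (hw : 0 ≤ w.fst) : ∃ A : Polar d →L[ℝ] Polar d, HasFDerivAt (coneMap Q x) A w ∧
      |A.det| = w.fst ^ d * conf w.snd ^ d := by
  obtain ⟨U, v, hv, hU, h⟩ := exists_sphParam_eq_stereo x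
  have hfst : HasFDerivAt (fun w : Polar d => w.fst) (WithLp.fstL 2 ℝ ℝ _) w :=
    (WithLp.fstL 2 ℝ ℝ (EuclideanSpace ℝ (Fin d))).hasFDerivAt
  have hsnd : HasFDerivAt (fun w : Polar d => w.snd) (WithLp.sndL 2 ℝ ℝ _) w :=
    (WithLp.sndL 2 ℝ ℝ (EuclideanSpace ℝ (Fin d))).hasFDerivAt
  have h1 := Q.symm.toContinuousLinearEquiv.toContinuousLinearMap.hasFDerivAt.comp w
    (hfst.smul ((hasFDerivAt_stereo U v w.snd).comp w hsnd))
  refine ⟨_, h1.congr_of_eventuallyEq (Filter.Eventually.of_forall fun w => by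
    simp [coneMap, h]), ?_⟩
  set A := (Q.symm.toContinuousLinearEquiv.toContinuousLinearMap).comp
    (w.fst • (stereoDeriv U v w.snd).comp (WithLp.sndL 2 ℝ ℝ (EuclideanSpace ℝ (Fin d))) +
      (WithLp.fstL 2 ℝ ℝ (EuclideanSpace ℝ (Fin d))).smulRight (stereo U v w.snd)) with hA
  have hAapp : ∀ η : Polar d, A η = Q.symm (w.fst • stereoDeriv U v w.snd η.snd
      + η.fst • stereo U v w.snd) := fun η => by simp [hA]
  have hinner : ∀ η η' : Polar d, inner ℝ (A η) (A η')
      = η.fst * η'.fst + (w.fst * conf w.snd) ^ 2 * inner ℝ η.snd η'.snd := by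
    intro η η'
    have h3 : ∀ w', inner ℝ (stereoDeriv U v w.snd w') (stereo U v w.snd) = 0 := fun w' => by
      rw [real_inner_comm]; exact inner_stereo_stereoDeriv hv hU _ _
    simp only [hAapp, LinearIsometryEquiv.inner_map_map, inner_add_left, inner_add_right,
      inner_smul_left, inner_smul_right, inner_stereoDeriv hv hU, inner_stereo_self hv hU,
      inner_stereo_stereoDeriv hv hU, h3, conj_trivial]
    ring
  have hdet : A.det ^ 2 = (w.fst ^ d * conf w.snd ^ d) ^ 2 := by
    rw [sq_det_eq_det_gram ((OrthonormalBasis.singleton Unit ℝ).prod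
      (EuclideanSpace.basisFun (Fin d) ℝ)) A]
    have hdiag : (Matrix.of fun i j => inner ℝ (A (((OrthonormalBasis.singleton Unit ℝ).prod
        (EuclideanSpace.basisFun (Fin d) ℝ)) i)) (A (((OrthonormalBasis.singleton Unit ℝ).prod
        (EuclideanSpace.basisFun (Fin d) ℝ)) j)) : Matrix (Unit ⊕ Fin d) (Unit ⊕ Fin d) ℝ)
        = Matrix.diagonal (Sum.elim (fun _ => 1) fun _ => (w.fst * conf w.snd) ^ 2) := by
      have ho := orthonormal_iff_ite.1 (EuclideanSpace.basisFun (Fin d) ℝ).orthonormal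
      simp only [EuclideanSpace.basisFun_apply] at ho
      ext i j
      rw [Matrix.of_apply, hinner, Matrix.diagonal_apply]
      rcases i with i | i <;> rcases j with j | j
      · simp [OrthonormalBasis.prod_apply]
      · simp [OrthonormalBasis.prod_apply]
      · simp [OrthonormalBasis.prod_apply]
      · simp [OrthonormalBasis.prod_apply, ho]
    rw [hdiag, Matrix.det_diagonal]
    simp
    ring
  have hnn : 0 ≤ w.fst ^ d * conf w.snd ^ d := mul_nonneg (pow_nonneg hw _)
    (pow_nonneg (conf_pos _).le _)
  have := (sq_eq_sq_iff_abs_eq_abs _ _).1 hdet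
  rwa [abs_of_nonneg hnn] at this

lemma norm_sphParam (x : Sph d) (y : EuclideanSpace ℝ (Fin d)) : ‖sphParam x y‖ = 1 :=
  norm_eq_of_mem_sphere _

lemma sphParam_injective (x : Sph d) : Function.Injective (sphParam x) := by
  intro y y' h
  have h1 := Subtype.val_injective h
  refine (extChartAt (𝓡 d) x).symm.injOn ?_ ?_ h1 <;>
    simp only [PartialEquiv.symm_source, extChartAt_sph_target, mem_univ]

lemma coneMap_injOn (Q : Polar d ≃ₗᵢ[ℝ] EuclideanSpace ℝ (Fin (d + 1))) (x : Sph d) :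
    InjOn (coneMap Q x) {w | 0 < w.fst} := by
  intro w hw w' hw' h
  have h1 : w.fst • sphParam x w.snd = w'.fst • sphParam x w'.snd := Q.symm.injective h
  have h2 := congrArg norm h1
  rw [norm_smul, norm_smul, norm_sphParam, norm_sphParam, mul_one, mul_one, Real.norm_eq_abs,
    Real.norm_eq_abs, abs_of_pos hw, abs_of_pos hw'] at h2
  rw [← h2] at h1
  have h3 := sphParam_injective x (smul_right_injective _ (ne_of_gt hw) h1)
  exact WithLp.ofLp_injective 2 (Prod.ext h2 h3)

/-- The volume of the cone over a set of the sphere, computed in the coordinates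
`(r, y) ↦ r • sphParam x y`, whose Jacobian is `(r * conf y) ^ d`. -/
lemma map_symm_le_toSphere (x : Sph d) :
    (volume.withDensity fun y => ENNReal.ofReal (conf y ^ d)).map (extChartAt (𝓡 d) x).symm
      ≤ (volume : Measure (EuclideanSpace ℝ (Fin (d + 1)))).toSphere := by
  obtain ⟨Q⟩ := exists_polar_isometry d
  have hσ := (continuous_extChartAt_sph_symm x).measurable
  refine Measure.le_iff.2 fun s hs => ?_
  rw [Measure.map_apply hσ hs, withDensity_apply _ (hσ hs), Measure.toSphere_apply' _ hs,
    finrank_euclideanSpace_fin]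
  set s' := (extChartAt (𝓡 d) x).symm ⁻¹' s with hs'
  have hs'm : MeasurableSet s' := hσ hs
  set S : Set (Polar d) := WithLp.ofLp ⁻¹' (Ioo (0 : ℝ) 1 ×ˢ s') with hS
  have hofLp := WithLp.volume_preserving_ofLp ℝ (EuclideanSpace ℝ (Fin d))
  have hSm : MeasurableSet S := hofLp.measurable (measurableSet_Ioo.prod hs'm)
  have hmemS : ∀ w : Polar d, w ∈ S ↔ (0 < w.fst ∧ w.fst < 1) ∧ w.snd ∈ s' := fun w => Iff.rfl
  choose A hA hAdet using exists_hasFDerivAt_coneMap Q x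
  set A' : Polar d → Polar d →L[ℝ] Polar d := fun w => if hw : 0 ≤ w.fst then A w hw else 0 with hA'
  have hcv := lintegral_image_eq_lintegral_abs_det_fderiv_mul volume hSm (f := coneMap Q x)
    (f' := A') (fun w hw => by
      have h0 : 0 ≤ w.fst := ((hmemS w).1 hw).1.1.le
      simp only [hA', dif_pos h0]
      exact (hA w h0).hasFDerivWithinAt)
    ((coneMap_injOn Q x).mono fun w hw => ((hmemS w).1 hw).1.1) 1
  simp only [Pi.one_apply, mul_one, lintegral_one, Measure.restrict_apply_univ] at hcv
  have hJ : ∫⁻ w in S, ENNReal.ofReal |(A' w).det|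
      = (∫⁻ r in Ioo (0 : ℝ) 1, ENNReal.ofReal (r ^ d)) *
        ∫⁻ y in s', ENNReal.ofReal (conf y ^ d) := by
    have h1 : ∫⁻ w in S, ENNReal.ofReal |(A' w).det|
        = ∫⁻ w in S, (fun z : ℝ × EuclideanSpace ℝ (Fin d) =>
          ENNReal.ofReal (z.1 ^ d) * ENNReal.ofReal (conf z.2 ^ d)) (WithLp.ofLp w) := by
      refine setLIntegral_congr_fun hSm fun w hw => ?_
      have h0 : 0 ≤ w.fst := ((hmemS w).1 hw).1.1.le
      simp only [hA', dif_pos h0, hAdet w h0]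
      exact ENNReal.ofReal_mul (pow_nonneg h0 _)
    have hm1 : Measurable fun r : ℝ => ENNReal.ofReal (r ^ d) := by fun_prop
    have hm2 : Measurable fun y : EuclideanSpace ℝ (Fin d) => ENNReal.ofReal (conf y ^ d) :=
      ENNReal.measurable_ofReal.comp (continuous_conf.pow d).measurable
    have hm3 : Measurable fun z : ℝ × EuclideanSpace ℝ (Fin d) =>
        ENNReal.ofReal (z.1 ^ d) * ENNReal.ofReal (conf z.2 ^ d) :=
      (hm1.comp measurable_fst).mul (hm2.comp measurable_snd)
    rw [h1, hofLp.setLIntegral_comp_preimage (measurableSet_Ioo.prod hs'm) hm3,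
      Measure.volume_eq_prod,
      ← Measure.prod_restrict, lintegral_prod_mul hm1.aemeasurable hm2.aemeasurable]
  have hr : ∫⁻ r in Ioo (0 : ℝ) 1, ENNReal.ofReal (r ^ d) = ENNReal.ofReal (1 / (d + 1)) := by
    rw [← ofReal_integral_eq_lintegral_ofReal
      ((Continuous.integrableOn_Icc (by fun_prop)).mono_set Ioo_subset_Icc_self)
      ((ae_restrict_iff' measurableSet_Ioo).2
        (Filter.Eventually.of_forall fun r hr => pow_nonneg hr.1.le _)),
      ← integral_Ioc_eq_integral_Ioo, ← intervalIntegral.integral_of_le zero_le_one, integral_pow]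
    simp
  have hsub : coneMap Q x '' S ⊆ Q ⁻¹' (Ioo (0 : ℝ) 1 • (Subtype.val '' s)) := by
    rintro _ ⟨w, hw, rfl⟩
    obtain ⟨hw1, hw2⟩ := (hmemS w).1 hw
    refine mem_preimage.2 ?_
    rw [coneMap, LinearIsometryEquiv.apply_symm_apply]
    exact smul_mem_smul hw1 ⟨_, hw2, rfl⟩
  have hQ : volume (Q ⁻¹' (Ioo (0 : ℝ) 1 • (Subtype.val '' s)))
      = volume (Ioo (0 : ℝ) 1 • (Subtype.val '' s : Set (EuclideanSpace ℝ (Fin (d + 1))))) :=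
    Q.measurePreserving.measure_preimage_emb Q.toHomeomorph.measurableEmbedding _
  have hfin := (measure_mono hsub).trans_eq hQ
  rw [hcv, hJ, hr] at hfin
  calc ∫⁻ y in s', ENNReal.ofReal (conf y ^ d)
      = ((d + 1 : ℕ) : ℝ≥0∞) * (ENNReal.ofReal (1 / (d + 1)) *
          ∫⁻ y in s', ENNReal.ofReal (conf y ^ d)) := by
        rw [← mul_assoc, ← ENNReal.ofReal_natCast, ← ENNReal.ofReal_mul (by positivity)]
        push_cast
        rw [mul_one_div_cancel (by positivity), ENNReal.ofReal_one, one_mul]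
    _ ≤ _ := by gcongr

end Cone

/-! ### The volume of the warped product -/

section WarpedVolume

variable {d : ℕ}

lemma cylBasis_addHaar : (cylBasis d).addHaar = volume := by
  have h : Orthonormal ℝ (Module.Basis.singleton Unit ℝ) := by
    rw [orthonormal_iff_ite]
    intro i j
    simp
  have h1 : (Module.Basis.singleton Unit ℝ).addHaar = volume := by
    rw [← OrthonormalBasis.addHaar_eq_volume
      ((Module.Basis.singleton Unit ℝ).toOrthonormalBasis h),
      Module.Basis.toBasis_toOrthonormalBasis]
  rw [cylBasis, Module.Basis.prod_addHaar, h1, OrthonormalBasis.addHaar_eq_volume]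
  rfl

lemma sqrt_det_metricInChart_warped (f : ℝ → ℝ) (x : ℝ × Sph d)
    (z : ℝ × EuclideanSpace ℝ (Fin d)) :
    √(metricInChart (cylModel d) (cylBasis d) (warpedMetric d f) x z).det
      = |f z.1| ^ d * conf z.2 ^ d := by
  rw [metricInChart_warped, Matrix.det_diagonal]
  have : ∏ i, warpedEntry d f i z = ((|f z.1| * conf z.2) ^ 2) ^ d := by
    simp [warpedEntry, mul_pow]
  rw [this, sqrt_pow_sq_prod (mul_nonneg (abs_nonneg _) (conf_pos _).le), mul_pow]

/-- Each chart measure of the cylinder is at most the product of the measure with density `|f| ^ d`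
on the line with the chart measure of the sphere. The majorant `D` is there because `f` need not be
measurable. -/
lemma riemannianVolume_warped_le (f : ℝ → ℝ) {D : ℝ → ℝ≥0∞} (hD : Measurable D)
    (hfD : ∀ t, ENNReal.ofReal (|f t| ^ d) ≤ D t) :
    riemannianVolume (cylModel d) (cylBasis d) (warpedMetric d f)
      ≤ (volume.withDensity D).prod
        (volume : Measure (EuclideanSpace ℝ (Fin (d + 1)))).toSphere := by
  refine iSup_le fun x => ?_
  have hσ := (continuous_extChartAt_sph_symm x.2).measurable
  have hsymm : ⇑(extChartAt (cylModel d) x).symm = Prod.map id (extChartAt (𝓡 d) x.2).symm :=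
    funext fun z => extChartAt_cyl_symm x z
  have hΦ : Measurable fun y : EuclideanSpace ℝ (Fin d) => ENNReal.ofReal (conf y ^ d) :=
    ENNReal.measurable_ofReal.comp (continuous_conf.pow d).measurable
  rw [chartVolume, extChartAt_cyl_target, Measure.restrict_univ, cylBasis_addHaar, hsymm]
  calc _ ≤ ((volume.withDensity D).prod
        (volume.withDensity fun y => ENNReal.ofReal (conf y ^ d))).map
          (Prod.map id (extChartAt (𝓡 d) x.2).symm) := by
        refine Measure.map_mono ?_ (measurable_id.prodMap hσ)
        rw [prod_withDensity hD hΦ]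
        refine withDensity_mono (Filter.Eventually.of_forall fun z => ?_)
        simp only
        rw [sqrt_det_metricInChart_warped, ENNReal.ofReal_mul (by positivity)]
        gcongr
        exact hfD z.1
    _ = (volume.withDensity D).prod ((volume.withDensity fun y => ENNReal.ofReal (conf y ^ d)).map
          (extChartAt (𝓡 d) x.2).symm) := by
        rw [← Measure.map_prod_map _ _ measurable_id hσ, Measure.map_id]
    _ ≤ _ := Measure.prod_mono le_rfl (map_symm_le_toSphere x.2)

lemma warpedVolume_le {a : ℝ} {f : ℝ → ℝ} (hf : IsWarpingFunction a f) :
    warpedVolume d a f ≤ ENNReal.ofReal (∫ t in (0 : ℝ)..a, f t ^ d) *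
      (volume : Measure (EuclideanSpace ℝ (Fin (d + 1)))).toSphere univ := by
  classical
  have hcont : ContinuousOn f (Icc 0 a) := hf.smooth.continuousOn
  -- Outside `(0, a)` nothing is known about `f`, not even measurability.
  set D : ℝ → ℝ≥0∞ := (Ioo 0 a).piecewise (fun t => ENNReal.ofReal (|f t| ^ d)) fun _ => ∞
    with hDdef
  have hD : Measurable D := by
    refine ContinuousOn.measurable_piecewise ?_ continuousOn_const measurableSet_Ioo
    exact ENNReal.continuous_ofReal.comp_continuousOn
      ((hcont.mono Ioo_subset_Icc_self).abs.pow d)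
  have hfD : ∀ t, ENNReal.ofReal (|f t| ^ d) ≤ D t := by
    intro t
    by_cases ht : t ∈ Ioo 0 a
    · rw [hDdef, piecewise_eq_of_mem _ _ _ ht]
    · rw [hDdef, piecewise_eq_of_notMem _ _ _ ht]
      exact le_top
  refine (Measure.le_iff'.1 (riemannianVolume_warped_le f hD hfD) _).trans (le_of_eq ?_)
  rw [regularPart, Measure.prod_prod, withDensity_apply _ measurableSet_Ioo]
  congr 1
  have h1 : ∫⁻ t in Ioo 0 a, D t = ∫⁻ t in Ioo 0 a, ENNReal.ofReal (f t ^ d) := by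
    refine setLIntegral_congr_fun measurableSet_Ioo fun t ht => ?_
    simp only [hDdef, piecewise_eq_of_mem _ _ _ ht, abs_of_pos (hf.pos t ht)]
  have hint : IntegrableOn (fun t => f t ^ d) (Ioo 0 a) :=
    (hcont.pow d).integrableOn_Icc.mono_set Ioo_subset_Icc_self
  rw [h1, ← ofReal_integral_eq_lintegral_ofReal hint
    ((ae_restrict_iff' measurableSet_Ioo).2
      (Filter.Eventually.of_forall fun t ht => pow_nonneg (hf.pos t ht).le _)),
    ← integral_Ioc_eq_integral_Ioo, ← intervalIntegral.integral_of_le hf.pos_length.le]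

end WarpedVolume

end WarpedFootball

open WarpedFootball in
theorem theorem1p3 (n : ℕ) (hn : 3 ≤ n) :
    ∃ ε : ℝ, 0 < ε ∧ ε < 1 ∧
      ∀ (a : ℝ) (f : ℝ → ℝ), IsWarpingFunction a f →
        (∀ x ∈ regularPart (n - 1) a, ∀ v : TangentSpace (cylModel (n - 1)) x,
          ε * ((n : ℝ) - 1) * warpedMetric (n - 1) f x v v ≤
            ricci (cylModel (n - 1)) (cylBasis (n - 1)) (warpedMetric (n - 1) f) x v v) →
        (∀ x ∈ regularPart (n - 1) a,
          (n : ℝ) * ((n : ℝ) - 1) ≤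
            scalarCurvature (cylModel (n - 1)) (cylBasis (n - 1)) (warpedMetric (n - 1) f) x) →
        warpedVolume (n - 1) a f ≤ sphereVolume n := by
  obtain ⟨k, rfl⟩ : ∃ k, n = k + 3 := ⟨n - 3, by omega⟩
  obtain ⟨ε, hε0, hε1, hε⟩ := exists_constant_forall_integral_le k
  refine ⟨ε, hε0, hε1, fun a f hf hric hsc => ?_⟩
  change ∀ x ∈ regularPart (k + 2) a, ∀ v : TangentSpace (cylModel (k + 2)) x, _ at hric
  have hcast : ((k + 3 : ℕ) : ℝ) - 1 = ((k + 2 : ℕ) : ℝ) := by push_cast; ring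
  have hcast' : ((k + 3 : ℕ) : ℝ) = ((k + 2 : ℕ) : ℝ) + 1 := by push_cast; ring
  rw [hcast] at hric hsc
  rw [hcast'] at hsc
  have hint := hε a f hf
    (fun t ht => radial_of_ricci_bound (d := k + 2) (by omega) hf hric ht)
    (fun t ht => by
      have := profile_bound_of_scalar_bound (d := k + 2) (by omega) hf hsc ht
      push_cast at this
      linarith)
  calc warpedVolume (k + 2) a f
      ≤ ENNReal.ofReal (∫ t in (0 : ℝ)..a, f t ^ (k + 2)) * _ := warpedVolume_le hf
    _ ≤ ENNReal.ofReal (∫ θ in (0 : ℝ)..Real.pi, Real.sin θ ^ (k + 2)) * _ := by gcongr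
    _ ≤ sphereVolume (k + 3) := le_sphereVolume (k + 2)
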